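/- Let $\{a,b\}^*$ be the free monoid of words over $\{a,b\}$. A right ideal is a set $R\subseteq\{a,b\}^*$ with $R\cdot\{a,b\}^*\subseteq R$; it is finitely generated if $R=\Gamma\cdot\{a,b\}^*$ for a finite set $\Gamma$, and essential if it meets every non-empty right ideal. A right-ideal isomorphism is a bijection $\varphi\colon R_1\to R_2$ between right ideals with $\varphi(ux)=\varphi(u)x$ for all $u\in R_1$, $x\in\{a,b\}^*$; it is maximal if no right-ideal isomorphism strictly extends it. The Thompson group $V$ is the set of all maximal isomorphisms between finitely generated essential right ideals of $\{a,b\}^*$, where the product $\varphi\cdot\psi$ is the maximum extension of the composite $\varphi\circ\psi$ ($\psi$ is applied first). For a finite subset $\Delta$ of $V$ let $\Delta^{\pm1}$ be the alphabet that consists of the elements of $\Delta$ and their formal inverses, and let $$\mathrm{WP}_\Delta=\{\,w\in(\Delta^{\pm1})^* : \text{the product in } V \text{ of the letters of } w \text{ is the identity}\,\}.$$ For $T\colon\mathbb N\to\mathbb N$, a language is in $\mathrm{NTime}(T(n))$ if it is the set of words accepted by a nondeterministic multi-tape Turing machine all of whose computations on inputs of length $n$ have at most $C\cdot T(n)+C$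 steps, for some constant $C$; it is in $\mathrm{coNTime}(T(n))$ if its complement is in $\mathrm{NTime}(T(n))$; and it is in $\mathrm{DTime}(T(n))$ if the machine can be chosen deterministic. **Proposition.** For every finite set $\Delta$ of generators of $V$ (and, more generally, for every finite subset $\Delta\subseteq V$), the word problem $\mathrm{WP}_\Delta$ of $V$ is in $\mathrm{coNTime}(n)$, in $\mathrm{NTime}(n^2)$, and in $\mathrm{DTime}(n^3)$, where $n=|w|$ is the length of the input word $w$ over $\Delta^{\pm1}$. -/

import Mathlib

/-! ### Right ideals of the free monoid `{a, b}*` -/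

namespace Thompson

/-- Finite words over the two-letter alphabet `{a, b}`; the letters are `false` and `true`. -/
abbrev Word : Type := List Bool

/-- `R · A* ⊆ R`. -/
def IsRightIdeal (R : Set Word) : Prop :=
  ∀ u ∈ R, ∀ x : Word, u ++ x ∈ R

/-- A right ideal is essential if it meets every (non-empty) right ideal. -/
def IsEssentialRightIdeal (R : Set Word) : Prop :=
  IsRightIdeal R ∧ ∀ J : Set Word, IsRightIdeal J → J.Nonempty → (R ∩ J).Nonempty

/-- `R = Γ · A*` for some finite set `Γ` of words. -/
def IsFGRightIdeal (R : Set Word) : Prop :=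
  ∃ Γ : Set Word, Γ.Finite ∧ R = {w | ∃ p ∈ Γ, ∃ x : Word, w = p ++ x}

/-- The domain of a partial injection of `{a, b}*`. -/
def dom (f : Word ≃. Word) : Set Word := {u | ∃ v, v ∈ f u}

/-- The range of a partial injection of `{a, b}*`. -/
def ran (f : Word ≃. Word) : Set Word := {v | ∃ u, v ∈ f u}

/-- Right-ideal isomorphisms: partial injections whose domain and range are right ideals and
which satisfy `f (u x) = f u x` for all `u` in the domain and all words `x`. -/
structure IsRightIdealIso (f : Word ≃. Word) : Prop where
  dom_rightIdeal : IsRightIdeal (dom f)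
  ran_rightIdeal : IsRightIdeal (ran f)
  map_append : ∀ u v : Word, v ∈ f u → ∀ x : Word, v ++ x ∈ f (u ++ x)

/-- Isomorphisms between finitely generated essential right ideals. -/
structure IsFGEssentialIso (f : Word ≃. Word) : Prop extends IsRightIdealIso f where
  dom_essential : IsEssentialRightIdeal (dom f)
  ran_essential : IsEssentialRightIdeal (ran f)
  dom_fg : IsFGRightIdeal (dom f)
  ran_fg : IsFGRightIdeal (ran f)

/-- A right-ideal isomorphism is maximal if no right-ideal isomorphism strictly extends it
(`f ≤ g` says that the partial map `g` extends `f`). -/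
def IsMaximalIso (f : Word ≃. Word) : Prop :=
  IsRightIdealIso f ∧ ∀ g : Word ≃. Word, IsRightIdealIso g → f ≤ g → g = f

theorem IsRightIdealIso.of_map_append {f : Word ≃. Word}
    (h : ∀ u v : Word, v ∈ f u → ∀ x : Word, v ++ x ∈ f (u ++ x)) : IsRightIdealIso f where
  dom_rightIdeal := fun u ⟨v, hv⟩ x => ⟨v ++ x, h u v hv x⟩
  ran_rightIdeal := fun v ⟨u, hv⟩ x => ⟨u ++ x, h u v hv x⟩
  map_append := h

theorem IsEssentialRightIdeal.exists_append {R : Set Word} (h : IsEssentialRightIdeal R)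
    (u : Word) : ∃ x : Word, u ++ x ∈ R := by
  obtain ⟨w, hw, x, rfl⟩ := h.2 {w | ∃ x : Word, w = u ++ x}
    (by rintro _ ⟨x, rfl⟩ y; exact ⟨x ++ y, by simp⟩) ⟨u, [], by simp⟩
  exact ⟨x, hw⟩

theorem exists_length_of_fg {R : Set Word} (h : IsEssentialRightIdeal R) (hf : IsFGRightIdeal R) :
    ∃ n : ℕ, ∀ w : Word, n ≤ w.length → w ∈ R := by
  obtain ⟨Γ, hΓ, hR⟩ := hf
  obtain ⟨n, hn⟩ := (hΓ.image List.length).bddAbove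
  refine ⟨n, fun w hw => ?_⟩
  obtain ⟨x, hx⟩ := h.exists_append w
  rw [hR] at hx
  obtain ⟨p, hp, y, hy⟩ := hx
  have hpn : p.length ≤ n := hn ⟨p, hp, rfl⟩
  have hpw : p <+: w :=
    List.prefix_of_prefix_length_le ⟨y, hy.symm⟩ ⟨x, rfl⟩ (hpn.trans hw)
  obtain ⟨t, ht⟩ := hpw
  rw [hR]
  exact ⟨p, hp, t, ht.symm⟩

theorem essential_and_fg_of_length {R : Set Word} (hR : IsRightIdeal R) (n : ℕ)
    (h : ∀ w : Word, n ≤ w.length → w ∈ R) : IsEssentialRightIdeal R ∧ IsFGRightIdeal R := by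
  refine ⟨⟨hR, ?_⟩, ?_⟩
  · rintro J hJ ⟨u, hu⟩
    exact ⟨u ++ List.replicate n false, h _ (by simp), hJ u hu _⟩
  · refine ⟨{w | w.length ≤ n ∧ w ∈ R}, (List.finite_length_le Bool n).subset fun w hw => hw.1, ?_⟩
    ext w
    constructor
    · intro hw
      by_cases hl : w.length ≤ n
      · exact ⟨w, ⟨hl, hw⟩, [], by simp⟩
      · refine ⟨w.take n, ⟨by simp, h _ ?_⟩, w.drop n, by simp⟩
        simp; omega
    · rintro ⟨p, ⟨-, hp⟩, x, rfl⟩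
      exact hR p hp x

theorem dom_symm (f : Word ≃. Word) : dom f.symm = ran f := by
  ext u
  exact exists_congr fun v => f.mem_iff_mem

theorem ran_symm (f : Word ≃. Word) : ran f.symm = dom f := by
  ext u
  exact exists_congr fun v => f.mem_iff_mem

theorem IsRightIdealIso.symm {f : Word ≃. Word} (h : IsRightIdealIso f) :
    IsRightIdealIso f.symm :=
  .of_map_append fun u v huv x => by
    rw [← PEquiv.mem_iff_mem] at huv ⊢
    exact h.map_append _ _ huv x

theorem IsRightIdealIso.trans {f g : Word ≃. Word} (hf : IsRightIdealIso f)
    (hg : IsRightIdealIso g) : IsRightIdealIso (f.trans g) :=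
  .of_map_append fun u v huv x => by
    rw [PEquiv.mem_trans] at huv ⊢
    obtain ⟨w, h1, h2⟩ := huv
    exact ⟨w ++ x, hf.map_append _ _ h1 x, hg.map_append _ _ h2 x⟩

theorem IsFGEssentialIso.symm {f : Word ≃. Word} (h : IsFGEssentialIso f) :
    IsFGEssentialIso f.symm where
  toIsRightIdealIso := h.toIsRightIdealIso.symm
  dom_essential := by rw [dom_symm]; exact h.ran_essential
  ran_essential := by rw [ran_symm]; exact h.dom_essential
  dom_fg := by rw [dom_symm]; exact h.ran_fg
  ran_fg := by rw [ran_symm]; exact h.dom_fg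

theorem dom_trans_length {f g : Word ≃. Word} (hf : IsFGEssentialIso f)
    (hg : IsFGEssentialIso g) : ∃ n : ℕ, ∀ w : Word, n ≤ w.length → w ∈ dom (f.trans g) := by
  obtain ⟨m, hm⟩ := exists_length_of_fg hf.dom_essential hf.dom_fg
  obtain ⟨n, hn⟩ := exists_length_of_fg hg.dom_essential hg.dom_fg
  refine ⟨m + n, fun w hw => ?_⟩
  obtain ⟨v, hv⟩ := hm (w.take m) (by simp; omega)
  have h1 := hf.map_append _ _ hv (w.drop m)
  rw [List.take_append_drop] at h1
  obtain ⟨z, hz⟩ := hn (v ++ w.drop m) (by simp; omega)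
  exact ⟨z, (PEquiv.mem_trans f g w z).2 ⟨_, h1, hz⟩⟩

/-- The composite of two isomorphisms between finitely generated essential right ideals is again
one. -/
theorem IsFGEssentialIso.trans {f g : Word ≃. Word} (hf : IsFGEssentialIso f)
    (hg : IsFGEssentialIso g) : IsFGEssentialIso (f.trans g) := by
  have hi := hf.toIsRightIdealIso.trans hg.toIsRightIdealIso
  obtain ⟨m, hm⟩ := dom_trans_length hf hg
  obtain ⟨n, hn⟩ := dom_trans_length hg.symm hf.symm
  rw [← PEquiv.symm_trans_rev, dom_symm] at hn
  obtain ⟨h1, h2⟩ := essential_and_fg_of_length hi.dom_rightIdeal m hm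
  obtain ⟨h3, h4⟩ := essential_and_fg_of_length hi.ran_rightIdeal n hn
  exact ⟨hi, h1, h3, h2, h4⟩

/-- An extension of an isomorphism between finitely generated essential right ideals is again
one. -/
theorem IsFGEssentialIso.of_le {f g : Word ≃. Word} (hf : IsFGEssentialIso f)
    (hg : IsRightIdealIso g) (h : f ≤ g) : IsFGEssentialIso g := by
  obtain ⟨m, hm⟩ := exists_length_of_fg hf.dom_essential hf.dom_fg
  obtain ⟨n, hn⟩ := exists_length_of_fg hf.ran_essential hf.ran_fg
  obtain ⟨h1, h2⟩ := essential_and_fg_of_length hg.dom_rightIdeal m fun w hw => by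
    obtain ⟨v, hv⟩ := hm w hw
    exact ⟨v, h _ _ hv⟩
  obtain ⟨h3, h4⟩ := essential_and_fg_of_length hg.ran_rightIdeal n fun w hw => by
    obtain ⟨v, hv⟩ := hn w hw
    exact ⟨v, h _ _ hv⟩
  exact ⟨hg, h1, h3, h2, h4⟩

/-! ### The maximum extension -/

/-- `v` is the value at `u` of some right-ideal isomorphism extending `f`. -/
def ExtRel (f : Word ≃. Word) (u v : Word) : Prop :=
  ∃ g : Word ≃. Word, IsRightIdealIso g ∧ f ≤ g ∧ v ∈ g u

theorem ExtRel.right_unique {f : Word ≃. Word} (hf : IsFGEssentialIso f) {u v v' : Word}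
    (h : ExtRel f u v) (h' : ExtRel f u v') : v = v' := by
  obtain ⟨g, hg, hle, hv⟩ := h
  obtain ⟨g', hg', hle', hv'⟩ := h'
  obtain ⟨x, w, hw⟩ := hf.dom_essential.exists_append u
  have h1 := Option.mem_unique (hg.map_append _ _ hv x) (hle _ _ hw)
  have h2 := Option.mem_unique (hg'.map_append _ _ hv' x) (hle' _ _ hw)
  exact List.append_cancel_right (h1.trans h2.symm)

theorem ExtRel.left_unique {f : Word ≃. Word} (hf : IsFGEssentialIso f) {u u' v : Word}
    (h : ExtRel f u v) (h' : ExtRel f u' v) : u = u' := by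
  obtain ⟨g, hg, hle, hv⟩ := h
  obtain ⟨g', hg', hle', hv'⟩ := h'
  obtain ⟨x, w, hw⟩ := hf.ran_essential.exists_append v
  have h1 := g.inj (hg.map_append _ _ hv x) (hle _ _ hw)
  have h2 := g'.inj (hg'.map_append _ _ hv' x) (hle' _ _ hw)
  exact List.append_cancel_right (h1.trans h2.symm)

open Classical in
/-- The maximum extension of `f`: the union of all right-ideal isomorphisms that extend `f`. -/
noncomputable def maxExt (f : Word ≃. Word) (hf : IsFGEssentialIso f) : Word ≃. Word where
  toFun u := if h : ∃ v, ExtRel f u v then some h.choose else none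
  invFun v := if h : ∃ u, ExtRel f u v then some h.choose else none
  inv u v := by
    constructor
    · intro h
      split_ifs at h with h1
      · have h2 : ExtRel f u v := Option.some.inj h ▸ h1.choose_spec
        have h3 : ∃ v, ExtRel f u v := ⟨v, h2⟩
        rw [dif_pos h3]
        exact congrArg some (ExtRel.right_unique hf h3.choose_spec h2)
    · intro h
      split_ifs at h with h1
      · have h2 : ExtRel f u v := Option.some.inj h ▸ h1.choose_spec
        have h3 : ∃ u, ExtRel f u v := ⟨u, h2⟩
        rw [dif_pos h3]
        exact congrArg some (ExtRel.left_unique hf h3.choose_spec h2)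

open Classical in
theorem mem_maxExt {f : Word ≃. Word} (hf : IsFGEssentialIso f) {u v : Word} :
    v ∈ maxExt f hf u ↔ ExtRel f u v := by
  change (v ∈ if h : ∃ v, ExtRel f u v then some h.choose else none) ↔ _
  constructor
  · intro h
    split_ifs at h with h1
    · exact Option.some.inj h ▸ h1.choose_spec
    · cases h
  · intro h
    have h3 : ∃ v, ExtRel f u v := ⟨v, h⟩
    rw [dif_pos h3]
    exact congrArg some (ExtRel.right_unique hf h3.choose_spec h)

theorem le_maxExt_of_le {f g : Word ≃. Word} (hf : IsFGEssentialIso f) (hg : IsRightIdealIso g)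
    (h : f ≤ g) : g ≤ maxExt f hf :=
  fun _ _ hv => (mem_maxExt hf).2 ⟨g, hg, h, hv⟩

theorem isRightIdealIso_maxExt {f : Word ≃. Word} (hf : IsFGEssentialIso f) :
    IsRightIdealIso (maxExt f hf) :=
  .of_map_append fun u v h x => by
    rw [mem_maxExt] at h ⊢
    obtain ⟨g, hg, hle, hv⟩ := h
    exact ⟨g, hg, hle, hg.map_append _ _ hv x⟩

theorem le_maxExt {f : Word ≃. Word} (hf : IsFGEssentialIso f) : f ≤ maxExt f hf :=
  le_maxExt_of_le hf hf.toIsRightIdealIso le_rfl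

theorem isMaximalIso_maxExt {f : Word ≃. Word} (hf : IsFGEssentialIso f) :
    IsMaximalIso (maxExt f hf) :=
  ⟨isRightIdealIso_maxExt hf, fun _ hg h =>
    le_antisymm (le_maxExt_of_le hf hg ((le_maxExt hf).trans h)) h⟩

theorem maxExt_eq_of_le {f g : Word ≃. Word} (hf : IsFGEssentialIso f) (hg : IsFGEssentialIso g)
    (h : f ≤ g) : maxExt f hf = maxExt g hg :=
  le_antisymm
    (le_maxExt_of_le hg (isRightIdealIso_maxExt hf)
      (le_maxExt_of_le hf hg.toIsRightIdealIso h))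
    (le_maxExt_of_le hf (isRightIdealIso_maxExt hg) (h.trans (le_maxExt hg)))

theorem maxExt_eq_self {f : Word ≃. Word} (hf : IsFGEssentialIso f) (hm : IsMaximalIso f) :
    maxExt f hf = f :=
  hm.2 _ (isRightIdealIso_maxExt hf) (le_maxExt hf)

theorem trans_le_trans {f f' g g' : Word ≃. Word} (hf : f ≤ f') (hg : g ≤ g') :
    f.trans g ≤ f'.trans g' := by
  intro u v h
  rw [PEquiv.mem_trans] at h ⊢
  obtain ⟨w, h1, h2⟩ := h
  exact ⟨w, hf _ _ h1, hg _ _ h2⟩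

theorem isFGEssentialIso_refl : IsFGEssentialIso (PEquiv.refl Word) := by
  have hi : IsRightIdealIso (PEquiv.refl Word) :=
    .of_map_append fun u v h x => by simp_all
  obtain ⟨h1, h2⟩ := essential_and_fg_of_length hi.dom_rightIdeal 0
    fun w _ => (⟨w, by simp⟩ : w ∈ dom (PEquiv.refl Word))
  obtain ⟨h3, h4⟩ := essential_and_fg_of_length hi.ran_rightIdeal 0
    fun w _ => (⟨w, by simp⟩ : w ∈ ran (PEquiv.refl Word))
  exact ⟨hi, h1, h3, h2, h4⟩

theorem isMaximalIso_refl : IsMaximalIso (PEquiv.refl Word) := by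
  refine ⟨isFGEssentialIso_refl.toIsRightIdealIso, fun g _ h => ?_⟩
  refine le_antisymm (fun u v hv => ?_) h
  have := Option.mem_unique hv (h u u (by simp))
  simp [this]

theorem IsMaximalIso.symm {f : Word ≃. Word} (hf : IsMaximalIso f) : IsMaximalIso f.symm := by
  refine ⟨hf.1.symm, fun g hg h => ?_⟩
  have : g.symm = f := hf.2 _ hg.symm fun u v hv => by
    rw [← PEquiv.mem_iff_mem]
    exact h _ _ (PEquiv.mem_iff_mem f |>.2 hv)
  rw [← this, PEquiv.symm_symm]

theorem trans_symm_le_refl (f : Word ≃. Word) : f.trans f.symm ≤ PEquiv.refl Word := by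
  intro u v h
  rw [PEquiv.mem_trans] at h
  obtain ⟨w, h1, h2⟩ := h
  rw [← PEquiv.mem_iff_mem] at h2
  rw [f.inj h1 h2]
  simp

/-! ### The Thompson group `V` -/

/-- The elements of the Thompson group `V`: the maximal isomorphisms between finitely generated
essential right ideals of `{a, b}*`. -/
structure V where
  toPEquiv : Word ≃. Word
  isFGEssentialIso : IsFGEssentialIso toPEquiv
  isMaximalIso : IsMaximalIso toPEquiv

@[ext]
theorem V.ext {φ ψ : V} (h : φ.toPEquiv = ψ.toPEquiv) : φ = ψ := by
  cases φ; cases ψ; cases h; rfl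

/-- The maximum extension, as an element of `V`. -/
noncomputable def V.ofIso (f : Word ≃. Word) (hf : IsFGEssentialIso f) : V where
  toPEquiv := maxExt f hf
  isFGEssentialIso := hf.of_le (isRightIdealIso_maxExt hf) (le_maxExt hf)
  isMaximalIso := isMaximalIso_maxExt hf

theorem V.ofIso_eq_of_le {f g : Word ≃. Word} (hf : IsFGEssentialIso f) (hg : IsFGEssentialIso g)
    (h : f ≤ g) : V.ofIso f hf = V.ofIso g hg :=
  V.ext (maxExt_eq_of_le hf hg h)

/-- The product `φ · ψ` is the maximum extension of `φ ∘ ψ` (`ψ` is applied first). -/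
noncomputable instance : Mul V where
  mul φ ψ := V.ofIso (ψ.toPEquiv.trans φ.toPEquiv) (ψ.isFGEssentialIso.trans φ.isFGEssentialIso)

/-- The identity map on `{a, b}*`. -/
noncomputable instance : One V where
  one := ⟨PEquiv.refl Word, isFGEssentialIso_refl, isMaximalIso_refl⟩

noncomputable instance : Inv V where
  inv φ := ⟨φ.toPEquiv.symm, φ.isFGEssentialIso.symm, φ.isMaximalIso.symm⟩

theorem V.mul_def (φ ψ : V) : φ * ψ = V.ofIso (ψ.toPEquiv.trans φ.toPEquiv)
    (ψ.isFGEssentialIso.trans φ.isFGEssentialIso) := rfl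

theorem V.ofIso_toPEquiv (φ : V) : V.ofIso φ.toPEquiv φ.isFGEssentialIso = φ :=
  V.ext (maxExt_eq_self φ.isFGEssentialIso φ.isMaximalIso)

noncomputable instance : Group V :=
  Group.ofLeftAxioms
    (by
      intro φ ψ ρ
      have h := ρ.isFGEssentialIso.trans (ψ.isFGEssentialIso.trans φ.isFGEssentialIso)
      trans V.ofIso _ h
      · exact (V.ofIso_eq_of_le h (ρ.isFGEssentialIso.trans (φ * ψ).isFGEssentialIso)
          (trans_le_trans le_rfl
            (le_maxExt (ψ.isFGEssentialIso.trans φ.isFGEssentialIso)))).symm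
      · refine V.ofIso_eq_of_le h ((ψ * ρ).isFGEssentialIso.trans φ.isFGEssentialIso) ?_
        rw [← PEquiv.trans_assoc]
        exact trans_le_trans (le_maxExt (ρ.isFGEssentialIso.trans ψ.isFGEssentialIso)) le_rfl)
    (by
      intro φ
      conv_rhs => rw [← V.ofIso_toPEquiv φ]
      exact V.ofIso_eq_of_le _ _ (PEquiv.trans_refl φ.toPEquiv).le)
    (by
      intro φ
      conv_rhs => rw [← V.ofIso_toPEquiv 1]
      exact V.ofIso_eq_of_le _ _ (trans_symm_le_refl φ.toPEquiv))

end Thompson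

/-! ### Multi-tape Turing machines and time complexity classes -/

namespace TimeComplexity

/-- A nondeterministic Turing machine with input alphabet `Γ`. It has an input tape (tape `0`,
which may be written on) and `workTapes` further tapes; all tapes are infinite in both directions.
A tape cell holds an input letter, an auxiliary letter, or the blank `none`. Depending on the state
and on the scanned letters, one step chooses a new state and, on every tape, a letter to be written
and a move of the head (`none`: the head does not move). -/
structure Machine (Γ : Type) where
  workTapes : ℕ
  State : Type
  stateFintype : Fintype State
  Aux : Type
  auxFintype : Fintype Aux
  start : State
  accept : Set State
  trans : State → (Fin (workTapes + 1) → Option (Γ ⊕ Aux)) →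
    Set (State × (Fin (workTapes + 1) → Option (Γ ⊕ Aux) × Option Turing.Dir))

namespace Machine

variable {Γ : Type} (M : Machine Γ)

/-- The contents of a tape cell. -/
abbrev Cell : Type := Option (Γ ⊕ M.Aux)

/-- A configuration: the state and the tapes with their head positions. -/
structure Cfg where
  state : M.State
  tape : Fin (M.workTapes + 1) → Turing.Tape M.Cell

/-- Write a letter on a tape, then move its head. -/
def writeMove (T : Turing.Tape M.Cell) (p : M.Cell × Option Turing.Dir) : Turing.Tape M.Cell :=
  match p.2 with
  | none => T.write p.1
  | some d => (T.write p.1).move d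

/-- The initial configuration: the input is written on tape `0`, with the head on its first letter,
and the other tapes are blank. -/
def init (w : List Γ) : M.Cfg where
  state := M.start
  tape i := if i = 0 then Turing.Tape.mk₁ (w.map fun a => some (Sum.inl a)) else Turing.Tape.mk₁ []

/-- One step of a computation. -/
def Step (c c' : M.Cfg) : Prop :=
  ∃ r ∈ M.trans c.state (fun i => (c.tape i).head),
    c' = ⟨r.1, fun i => M.writeMove (c.tape i) (r.2 i)⟩

/-- `M.Computes t c c'`: some computation leads from `c` to `c'` in exactly `t` steps. -/
inductive Computes : ℕ → M.Cfg → M.Cfg → Prop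
  | zero (c : M.Cfg) : Computes 0 c c
  | succ {t : ℕ} {c c' c'' : M.Cfg} : Computes t c c' → M.Step c' c'' → Computes (t + 1) c c''

/-- No step is possible. -/
def Halted (c : M.Cfg) : Prop := ∀ c', ¬ M.Step c c'

/-- The input `w` is accepted if some computation on `w` halts in an accepting state. -/
def Accepts (w : List Γ) : Prop :=
  ∃ t c, M.Computes t (M.init w) c ∧ M.Halted c ∧ c.state ∈ M.accept

/-- Every computation on every input `w` has at most `T |w|` steps. -/
def RunsInTime (T : ℕ → ℕ) : Prop :=
  ∀ w t c, M.Computes t (M.init w) c → t ≤ T w.length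

/-- At most one step is possible in every situation. -/
def Deterministic : Prop := ∀ q s, (M.trans q s).Subsingleton

end Machine

/-- The languages that are accepted by a nondeterministic multi-tape Turing machine all of whose
computations have `O(T(n))` steps on inputs of length `n`. (The additive constant covers the
inputs of length `n` with `T(n) = 0`, such as the empty word.) -/
def NTime {Γ : Type} (T : ℕ → ℕ) : Set (Set (List Γ)) :=
  {L | ∃ (M : Machine Γ) (C : ℕ), M.RunsInTime (fun n => C * T n + C) ∧ ∀ w, w ∈ L ↔ M.Accepts w}

/-- The languages whose complement is in `NTime T`. -/
def coNTime {Γ : Type} (T : ℕ → ℕ) : Set (Set (List Γ)) :=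
  {L | Lᶜ ∈ NTime T}

/-- The languages that are decided by a deterministic multi-tape Turing machine in `O(T(n))`
steps on inputs of length `n`. -/
def DTime {Γ : Type} (T : ℕ → ℕ) : Set (Set (List Γ)) :=
  {L | ∃ (M : Machine Γ) (C : ℕ), M.Deterministic ∧ M.RunsInTime (fun n => C * T n + C) ∧
    ∀ w, w ∈ L ↔ M.Accepts w}

end TimeComplexity

/-! ### Word problems -/

/-- The letter `(x, true)` of the alphabet `Δ^{±1}` stands for `x`, and `(x, false)` for `x⁻¹`. -/
def letterValue {G : Type} [Group G] {Δ : Finset G} (a : Δ × Bool) : G :=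
  if a.2 then (a.1 : G) else (a.1 : G)⁻¹

/-- The word problem of `G` over the finite set `Δ ⊆ G`: all words over the alphabet `Δ^{±1}` whose
product is the identity of `G`. -/
def wordProblem {G : Type} [Group G] (Δ : Finset G) : Set (List (Δ × Bool)) :=
  {w | (w.map letterValue).prod = 1}

/-!
A word `w` over the generators represents the identity if and only if the composite `g` of the maps
of its letters is a restriction of the identity. All maps are given by finite tables, so `g` is
defined at all words of length at least `K * w.length`, and its domain is generated by a prefix code
of words of at most this length. Hence `g` is a restriction of the identity if and only if it fixes
every word of the code. The code of `f ∘ g` embeds into the disjoint union of the codes of `f` and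
`g`, so the code of a composite of `n` maps has only `O(n)` words.

The machine keeps a guess `u` on one tape and its image on a stack, and applies the map of each
letter of `w` in constant time, since a map only changes a bounded prefix of a word. It asks for a
further letter of `u` only if the image is too short for the next map, so that the final guess is a
word of the code; then it compares `u` with its image. If the letters are guessed
nondeterministically, then this takes linear time and recognizes the complement of the word
problem. If a deterministic machine runs through the words of the code in the lexicographic order
instead, then it needs `O(n)` passes of time `O(n)`.
-/

namespace Thompson

/-! ### Prefix codes -/

section PrefixCode

variable {α : Type*} {R : Set (List α)} {u : List α}

/-- No proper prefix of `u` belongs to `R`; the word `u` itself may or may not belong to `R`. -/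
def NoProperPrefix (R : Set (List α)) (u : List α) : Prop := ∀ v ∈ R, v <+: u → v = u

/-- The minimal words of `R` in the prefix order. They form a prefix code, which generates `R` if
`R` is a right ideal. -/
def prefixCode (R : Set (List α)) : Set (List α) := {u ∈ R | NoProperPrefix R u}

theorem noProperPrefix_nil (R : Set (List α)) : NoProperPrefix R [] :=
  fun _ _ hv => List.prefix_nil.1 hv

theorem NoProperPrefix.concat (h : NoProperPrefix R u) (hu : u ∉ R) (b : α) :
    NoProperPrefix R (u ++ [b]) := by
  intro v hvR hv
  rcases List.prefix_concat_iff.1 hv with rfl | hv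
  · rfl
  · exact absurd (h v hvR hv ▸ hvR) hu

theorem NoProperPrefix.of_prefix (h : NoProperPrefix R u) {v : List α} (hv : v <+: u) :
    NoProperPrefix R v :=
  fun w hwR hw => hw.eq_of_length_le (h w hwR (hw.trans hv) ▸ hv.length_le)

theorem NoProperPrefix.sibling (h : NoProperPrefix R u) {q : List α} {b : α}
    (hq : q ++ [b] <+: u) (c : α) : NoProperPrefix R (q ++ [c]) := by
  refine (h.of_prefix ((List.prefix_append q [b]).trans hq)).concat (fun hqR => ?_) c
  have hqu := h q hqR ((List.prefix_append q [b]).trans hq)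
  simpa [hqu] using hq.length_le

theorem NoProperPrefix.length_le {n : ℕ} (hR : ∀ u, n ≤ u.length → u ∈ R)
    (h : NoProperPrefix R u) : u.length ≤ n := by
  by_contra! hn
  have htake := congrArg List.length (h (u.take n) (hR _ (by simp [hn.le])) (u.take_prefix n))
  rw [List.length_take, min_eq_left hn.le] at htake
  exact hn.ne htake

theorem exists_prefix_mem_prefixCode (hu : u ∈ R) : ∃ p ∈ prefixCode R, p <+: u := by
  obtain ⟨p, ⟨hpR, hpu⟩, hmin⟩ :=
    WellFounded.has_min (measure List.length).wf {p ∈ R | p <+: u} ⟨u, hu, List.prefix_rfl⟩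
  exact ⟨p, ⟨hpR, fun v hvR hvp => hvp.eq_of_length_le
    (not_lt.1 (hmin v ⟨hvR, hvp.trans hpu⟩))⟩, hpu⟩

theorem prefixCode_univ : prefixCode (Set.univ : Set (List α)) = {[]} := by
  ext u
  refine ⟨fun hu => (hu.2 [] trivial List.nil_prefix).symm, ?_⟩
  rintro rfl
  exact ⟨trivial, noProperPrefix_nil _⟩

theorem finite_prefixCode [Finite α] {n : ℕ} (hR : ∀ u, n ≤ u.length → u ∈ R) :
    (prefixCode R).Finite :=
  (List.finite_length_le α n).subset fun _ hu => hu.2.length_le hR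

end PrefixCode

theorem mem_dom_trans_iff {f g : Word ≃. Word} {u v : Word} (hv : v ∈ f u) :
    u ∈ dom (f.trans g) ↔ v ∈ dom g := by
  simp [dom, Option.mem_def.1 hv, PEquiv.trans]

theorem prefixCode_dom_trans_subset {f g : Word ≃. Word} (hf : IsRightIdealIso f)
    (hg : IsRightIdealIso g) :
    prefixCode (dom (f.trans g)) ⊆
      prefixCode (dom f) ∪ (fun v => (f.symm v).getD []) '' prefixCode (dom g) := by
  rintro u ⟨⟨z, hz⟩, hmin⟩
  obtain ⟨v, hv, hvz⟩ := (PEquiv.mem_trans f g u z).1 hz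
  by_cases hu : NoProperPrefix (dom f) u
  · exact .inl ⟨⟨v, hv⟩, hu⟩
  refine .inr ⟨v, ⟨⟨z, hvz⟩, fun w hw hwv => ?_⟩,
    by simp [Option.mem_def.1 ((PEquiv.mem_iff_mem f).2 hv)]⟩
  simp only [NoProperPrefix, not_forall] at hu
  obtain ⟨p, ⟨q, hq⟩, ⟨t, rfl⟩, hne⟩ := hu
  obtain rfl : v = q ++ t := Option.mem_unique hv (hf.map_append _ _ hq t)
  rcases List.prefix_or_prefix_of_prefix hwv (List.prefix_append q t) with ⟨s, rfl⟩ | ⟨s, rfl⟩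
  · refine absurd (hmin p ?_ (List.prefix_append p t)) hne
    exact (mem_dom_trans_iff hq).2 (hg.dom_rightIdeal w hw s)
  · have hs : p ++ s ∈ dom (f.trans g) := (mem_dom_trans_iff (hf.map_append _ _ hq s)).2 hw
    have hpt := hmin _ hs (by simpa using hwv)
    rw [List.append_cancel_left hpt]

theorem encard_prefixCode_dom_trans_le {f g : Word ≃. Word} (hf : IsRightIdealIso f)
    (hg : IsRightIdealIso g) :
    (prefixCode (dom (f.trans g))).encard ≤
      (prefixCode (dom f)).encard + (prefixCode (dom g)).encard :=
  (Set.encard_le_encard (prefixCode_dom_trans_subset hf hg)).trans <|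
    (Set.encard_union_le _ _).trans <| by grw [Set.encard_image_le]

/-! ### Composites of finitely many right-ideal isomorphisms -/

section Composite

variable {Γ α : Type*}

/-- The composite of the maps `f a`, where `a` runs through the letters of a word; the map of the
first letter is applied first. -/
def composite (f : Γ → α ≃. α) : List Γ → (α ≃. α)
  | [] => PEquiv.refl α
  | a :: w => (f a).trans (composite f w)

theorem composite_append (f : Γ → α ≃. α) (w w' : List Γ) :
    composite f (w ++ w') = (composite f w).trans (composite f w') := by
  induction w with
  | nil => simp [composite]
  | cons a w ih => simp [composite, ih, PEquiv.trans_assoc]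

end Composite

/-- All maps of the family `f` are given by finite tables: they are right-ideal isomorphisms whose
values at the words of length at most `K`, which have length at most `B`, determine the map. -/
structure IsTableFamily {Γ : Type*} (f : Γ → Word ≃. Word) (K B : ℕ) : Prop where
  iso : ∀ a, IsRightIdealIso (f a)
  mem_dom : ∀ a (u : Word), K ≤ u.length → u ∈ dom (f a)
  le : K ≤ B
  length_le : ∀ a (u v : Word), u.length ≤ K → v ∈ f a u → v.length ≤ B

theorem exists_isTableFamily {Γ : Type*} [Finite Γ] {f : Γ → Word ≃. Word}
    (hf : ∀ a, IsFGEssentialIso (f a)) : ∃ K B, IsTableFamily f K B := by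
  choose n hn using fun a => exists_length_of_fg (hf a).dom_essential (hf a).dom_fg
  obtain ⟨K, hK⟩ := (Set.finite_range n).bddAbove
  have hfin : ((fun p : Γ × Word => ((f p.1 p.2).getD []).length) ''
      Set.univ ×ˢ {u | u.length ≤ K}).Finite :=
    (Set.finite_univ.prod (List.finite_length_le Bool K)).image _
  obtain ⟨B, hB⟩ := hfin.bddAbove
  refine ⟨K, max K B, fun a => (hf a).toIsRightIdealIso,
    fun a u hu => hn a u ((hK ⟨a, rfl⟩).trans hu), le_max_left _ _, fun a u v hu hv => ?_⟩
  refine (hB ⟨(a, u), ⟨trivial, hu⟩, ?_⟩).trans (le_max_right _ _)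
  simp [Option.mem_def.1 hv]

namespace IsTableFamily

variable {Γ : Type*} {f : Γ → Word ≃. Word} {K B : ℕ}

theorem composite_iso (h : IsTableFamily f K B) (w : List Γ) :
    IsRightIdealIso (composite f w) := by
  induction w with
  | nil => exact isFGEssentialIso_refl.toIsRightIdealIso
  | cons a w ih => exact (h.iso a).trans ih

theorem mem_dom_composite (h : IsTableFamily f K B) (w : List Γ) (u : Word)
    (hu : K * w.length ≤ u.length) : u ∈ dom (composite f w) := by
  induction w generalizing u with
  | nil => exact ⟨u, rfl⟩
  | cons a w ih =>
    rw [List.length_cons, mul_add_one] at hu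
    obtain ⟨v, hv⟩ := h.mem_dom a (u.take K) (by simp; omega)
    have hvu := (h.iso a).map_append _ _ hv (u.drop K)
    rw [List.take_append_drop] at hvu
    exact (mem_dom_trans_iff hvu).2 (ih _ (by simp; omega))

theorem exists_encard_prefixCode_le [Finite Γ] (h : IsTableFamily f K B) :
    ∃ D : ℕ, ∀ w,
      (prefixCode (dom (composite f w))).encard ≤ ((D * w.length + 1 : ℕ) : ℕ∞) := by
  obtain ⟨D, hD⟩ := (Set.finite_range fun a => (prefixCode (dom (f a))).ncard).bddAbove
  have hletter (a : Γ) : (prefixCode (dom (f a))).encard ≤ D := by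
    rw [← (finite_prefixCode (h.mem_dom a)).cast_ncard_eq]
    exact_mod_cast hD ⟨a, rfl⟩
  refine ⟨D, fun w => ?_⟩
  induction w with
  | nil =>
    have huniv : dom (composite f []) = Set.univ := Set.eq_univ_of_forall fun u => ⟨u, rfl⟩
    simp [huniv, prefixCode_univ]
  | cons a w ih =>
    calc _ ≤ _ := encard_prefixCode_dom_trans_le (h.iso a) (h.composite_iso w)
      _ ≤ (D : ℕ∞) + ((D * w.length + 1 : ℕ) : ℕ∞) := add_le_add (hletter a) ih
      _ = _ := by rw [List.length_cons]; norm_cast; ring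

end IsTableFamily

/-! ### The word problem in terms of composites -/

theorem V.ofIso_eq_one_iff {g : Word ≃. Word} (hg : IsFGEssentialIso g) :
    V.ofIso g hg = 1 ↔ g ≤ PEquiv.refl Word := by
  constructor
  · intro h
    have hmax : maxExt g hg = PEquiv.refl Word := congrArg V.toPEquiv h
    exact hmax ▸ le_maxExt hg
  · intro h
    rw [V.ofIso_eq_of_le hg isFGEssentialIso_refl h]
    exact V.ofIso_toPEquiv 1

section Composite

variable {Γ : Type*}

theorem isFGEssentialIso_composite {f : Γ → Word ≃. Word} (hf : ∀ a, IsFGEssentialIso (f a))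
    (w : List Γ) : IsFGEssentialIso (composite f w) := by
  induction w with
  | nil => exact isFGEssentialIso_refl
  | cons a w ih => exact (hf a).trans ih

/-- The inverses appear because the map of the last letter of `w` is the first one to be applied in
the product, whereas a machine meets the first letter first. -/
theorem ofIso_composite_inv (x : Γ → V) (w : List Γ) :
    V.ofIso (composite (fun a => (x a)⁻¹.toPEquiv) w)
      (isFGEssentialIso_composite (fun a => (x a)⁻¹.isFGEssentialIso) w) = (w.map x).prod⁻¹ := by
  induction w with
  | nil =>
    rw [List.map_nil, List.prod_nil, inv_one]
    exact V.ofIso_toPEquiv 1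
  | cons a w ih =>
    rw [List.map_cons, List.prod_cons, mul_inv_rev, ← ih]
    have h := isFGEssentialIso_composite (fun a => (x a)⁻¹.isFGEssentialIso) w
    exact V.ofIso_eq_of_le _ ((x a)⁻¹.isFGEssentialIso.trans (V.ofIso _ h).isFGEssentialIso)
      (trans_le_trans le_rfl (le_maxExt h))

theorem prod_eq_one_iff (x : Γ → V) (w : List Γ) :
    (w.map x).prod = 1 ↔ composite (fun a => (x a)⁻¹.toPEquiv) w ≤ PEquiv.refl Word := by
  rw [← V.ofIso_eq_one_iff (isFGEssentialIso_composite (fun a => (x a)⁻¹.isFGEssentialIso) w),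
    ofIso_composite_inv, inv_eq_one]

end Composite

theorem IsRightIdealIso.le_refl_iff {g : Word ≃. Word} (hg : IsRightIdealIso g) :
    g ≤ PEquiv.refl Word ↔ ∀ u ∈ prefixCode (dom g), u ∈ g u := by
  constructor
  · rintro h u ⟨⟨v, hv⟩, -⟩
    obtain rfl : u = v := by simpa using h u v hv
    exact hv
  · intro h u v hv
    obtain ⟨p, hp, x, rfl⟩ := exists_prefix_mem_prefixCode (show u ∈ dom g from ⟨v, hv⟩)
    obtain rfl := Option.mem_unique hv (hg.map_append _ _ (h p hp) x)
    simp

/-! ### The lexicographic order -/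

theorem replicate_true_prefix_of_lt {n : ℕ} {v : Word} (h : List.replicate n true < v) :
    List.replicate n true <+: v := by
  induction n generalizing v with
  | zero => exact List.nil_prefix
  | succ n ih =>
    rcases v with _ | ⟨b, v⟩
    · exact absurd h (List.not_lt_nil _)
    · rw [List.replicate_succ, List.cons_lt_cons_iff] at h
      rw [List.replicate_succ, List.cons_prefix_cons]
      rcases h with h | ⟨rfl, h⟩
      · exact absurd h (Bool.le_true b).not_gt
      · exact ⟨rfl, ih h⟩

theorem lt_concat_false_iff {u v : Word} : v < u ++ [false] ↔ v ≤ u := by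
  rw [le_iff_lt_or_eq]
  induction u generalizing v with
  | nil => rcases v with _ | ⟨b, v⟩ <;> simp [List.cons_lt_cons_iff]
  | cons a u ih =>
    rcases v with _ | ⟨b, v⟩
    · simp
    · simp only [List.cons_append, List.cons_lt_cons_iff, ih, List.cons.injEq]
      tauto

theorem concat_true_le_iff {q v : Word} {n : ℕ}
    (h : q ++ false :: List.replicate n true <+: v → v = q ++ false :: List.replicate n true) :
    q ++ [true] ≤ v ↔ q ++ false :: List.replicate n true < v := by
  rw [← not_lt, not_iff_comm]
  induction q generalizing v with
  | nil =>
    rcases v with _ | ⟨_ | _, v⟩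
    · simp
    · suffices ¬ List.replicate n true < v by simpa [List.cons_lt_cons_iff]
      intro hlt
      have hv := h (by simpa using replicate_true_prefix_of_lt hlt)
      simp_all
    · simp [List.cons_lt_cons_iff]
  | cons a q ih =>
    rcases v with _ | ⟨b, v⟩
    · simp
    · simp only [List.cons_append, List.cons_lt_cons_iff, List.cons.injEq,
        List.cons_prefix_cons] at h ⊢
      grind

end Thompson

namespace TimeComplexity

/-! ### Step counting on abstract transition relations -/

section Within

variable {α : Type*} {R : α → α → Prop} {Q Q' : α → Prop} {s t : ℕ} {a b : α}

/-- Every path of `R` that starts at `a` meets `Q` after at most `t` steps, and does not get stuck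
before. -/
inductive Within (R : α → α → Prop) (Q : α → Prop) : ℕ → α → Prop
  | here {t : ℕ} {a : α} : Q a → Within R Q t a
  | step {t : ℕ} {a : α} : (∃ b, R a b) → (∀ b, R a b → Within R Q t b) → Within R Q (t + 1) a

namespace Within

theorem mono (h : Within R Q s a) (hst : s ≤ t) : Within R Q t a := by
  induction h generalizing t with
  | here h => exact here h
  | step hex _ ih =>
    obtain ⟨t, rfl⟩ := Nat.exists_eq_add_of_le' (le_of_add_le_right hst)
    exact step hex fun b hb => ih b hb (by omega)

theorem bind (h : Within R Q s a) (hQ : ∀ b, Q b → Within R Q' t b) : Within R Q' (s + t) a := by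
  induction h with
  | here h => exact (hQ _ h).mono (by omega)
  | step hex _ ih =>
    rw [add_right_comm]
    exact step hex ih

theorem imp (h : Within R Q t a) (hQ : ∀ b, Q b → Q' b) : Within R Q' t a :=
  h.bind (t := 0) fun b hb => here (hQ b hb)

theorem of_unique_step (hR : ∀ c, R a c ↔ c = b) (h : Within R Q t b) : Within R Q (t + 1) a :=
  step ⟨b, (hR b).2 rfl⟩ fun c hc => (hR c).1 hc ▸ h

end Within

end Within

namespace Machine

variable {Γ : Type} {M : Machine Γ}

theorem Computes.head {t : ℕ} {c c' c'' : M.Cfg} (h : M.Step c c') (h' : M.Computes t c' c'') :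
    M.Computes (t + 1) c c'' := by
  induction h' with
  | zero => exact .succ (.zero _) h
  | succ _ hlast ih => exact .succ (ih h) hlast

theorem Computes.exists_head {t : ℕ} {c c'' : M.Cfg} (h : M.Computes (t + 1) c c'') :
    ∃ c', M.Step c c' ∧ M.Computes t c' c'' := by
  induction t generalizing c'' with
  | zero =>
    obtain _ | ⟨hzero, hlast⟩ := h
    cases hzero
    exact ⟨_, hlast, .zero _⟩
  | succ t ih =>
    obtain _ | ⟨hinit, hlast⟩ := h
    obtain ⟨c', hfirst, hmid⟩ := ih hinit
    exact ⟨c', hfirst, .succ hmid hlast⟩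

/-- The configurations `conc a` of the machine `M` make exactly the steps of the abstract transition
relation `R`. -/
def Realizes {α : Type*} (M : Machine Γ) (R : α → α → Prop) (conc : α → M.Cfg) : Prop :=
  ∀ a d, M.Step (conc a) d ↔ ∃ b, R a b ∧ d = conc b

namespace Realizes

variable {α : Type*} {R : α → α → Prop} {Q : α → Prop} {conc : α → M.Cfg} {s t : ℕ} {a : α}

theorem halted_iff (hM : M.Realizes R conc) : M.Halted (conc a) ↔ ∀ b, ¬ R a b := by
  constructor
  · exact fun h b hb => h _ ((hM a _).2 ⟨b, hb, rfl⟩)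
  · rintro h d hd
    obtain ⟨b, hb, -⟩ := (hM a d).1 hd
    exact h b hb

theorem of_computes (hM : M.Realizes R conc) (h : Within R Q t a)
    (hQ : ∀ b, Q b → ∀ c, ¬ R b c) {d : M.Cfg} (hd : M.Computes s (conc a) d) :
    s ≤ t ∧ (M.Halted d → ∃ b, Q b ∧ d = conc b) := by
  induction h generalizing s with
  | here h =>
    cases s with
    | zero =>
      cases hd
      exact ⟨Nat.zero_le _, fun _ => ⟨_, h, rfl⟩⟩
    | succ s =>
      obtain ⟨c, hfirst, -⟩ := hd.exists_head
      exact absurd hfirst (hM.halted_iff.2 (hQ _ h) c)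
  | step hex _ ih =>
    cases s with
    | zero =>
      cases hd
      obtain ⟨b, hb⟩ := hex
      exact ⟨Nat.zero_le _, fun hhalt => absurd hb (hM.halted_iff.1 hhalt b)⟩
    | succ s =>
      obtain ⟨c, hfirst, hrest⟩ := hd.exists_head
      obtain ⟨b, hb, rfl⟩ := (hM _ _).1 hfirst
      exact ⟨Nat.succ_le_succ (ih b hb hrest).1, (ih b hb hrest).2⟩

theorem exists_computes {R' : α → α → Prop} (hM : M.Realizes R conc) (hR : R' ≤ R)
    (h : Within R' Q t a) : ∃ s b, M.Computes s (conc a) (conc b) ∧ Q b := by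
  induction h with
  | here h => exact ⟨0, _, .zero _, h⟩
  | step hex _ ih =>
    obtain ⟨b, hb⟩ := hex
    obtain ⟨s, c, hcomp, hc⟩ := ih b hb
    exact ⟨s + 1, c, hcomp.head ((hM _ _).2 ⟨b, hR _ _ hb, rfl⟩), hc⟩

/-- Completeness only needs the computations of a restriction `R'` of the nondeterminism, which may
depend on the input. -/
theorem accepts_iff (hM : M.Realizes R conc) {w : List Γ} (hw : M.init w = conc a)
    (h : Within R Q t a) (hQ : ∀ b, Q b → ∀ c, ¬ R b c) {P : Prop}
    (hsound : ∀ b, Q b → (conc b).state ∈ M.accept → P)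
    (hcomplete : P → ∃ R' ≤ R,
      Within R' (fun b => (∀ c, ¬ R b c) ∧ (conc b).state ∈ M.accept) t a) :
    M.Accepts w ↔ P := by
  constructor
  · rintro ⟨s, d, hcomp, hhalt, hacc⟩
    rw [hw] at hcomp
    obtain ⟨b, hb, rfl⟩ := (hM.of_computes h hQ hcomp).2 hhalt
    exact hsound b hb hacc
  · intro hP
    obtain ⟨R', hR, hwithin⟩ := hcomplete hP
    obtain ⟨s, b, hcomp, hhalt, hacc⟩ := hM.exists_computes hR hwithin
    exact ⟨s, conc b, hw ▸ hcomp, hM.halted_iff.2 hhalt, hacc⟩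

end Realizes

end Machine

section Classes

variable {Γ : Type} {T T' : ℕ → ℕ}

theorem dTime_subset_nTime : (DTime T : Set (Set (List Γ))) ⊆ NTime T :=
  fun _ ⟨M, C, _, hC, hL⟩ => ⟨M, C, hC, hL⟩

theorem dTime_mono (h : T ≤ T') : (DTime T : Set (Set (List Γ))) ⊆ DTime T' :=
  fun _ ⟨M, C, hM, hC, hL⟩ =>
    ⟨M, C, hM, fun w t c hc =>
      (hC w t c hc).trans (Nat.add_le_add_right (Nat.mul_le_mul_left C (h _)) C), hL⟩

end Classes

/-! ### Tapes with finitely many non-blank cells -/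

section ListTape

open Turing

variable {α β : Type*}

/-- The tape whose non-blank cells hold `l.reverse` to the left of the head and `r` at the head and
to its right. -/
def listTape (e : α → β) (l r : List α) : Tape (Option β) :=
  Tape.mk' (ListBlank.mk (l.map fun x => some (e x))) (ListBlank.mk (r.map fun x => some (e x)))

variable {e : α → β} (x y : α) (l r : List α)

theorem listBlank_mk_singleton_none : ListBlank.mk [(none : Option β)] = ListBlank.mk [] :=
  Quotient.sound (Or.inr ⟨1, rfl⟩)

@[simp] theorem listTape_head_cons : (listTape e l (x :: r)).head = some (e x) := rfl

@[simp] theorem listTape_head_nil : (listTape e l []).head = none := rfl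

@[simp] theorem listTape_head_left_nil : ((listTape e [] r).move .left).head = none := by
  simp only [listTape, Tape.move_left_mk', Tape.mk'_head, ListBlank.head_cons]
  rfl

@[simp] theorem listTape_left_cons :
    (listTape e (x :: l) r).move .left = listTape e l (x :: r) := by
  simp [listTape]

@[simp] theorem listTape_right_cons :
    (listTape e l (x :: r)).move .right = listTape e (x :: l) r := by
  simp [listTape]

@[simp] theorem listTape_write_cons :
    (listTape e l (x :: r)).write (some (e y)) = listTape e l (y :: r) := by
  simp [listTape, Tape.write_mk']

@[simp] theorem listTape_write_nil : (listTape e l []).write (some (e y)) = listTape e l [y] := by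
  simp only [listTape, Tape.write_mk']
  rfl

@[simp] theorem listTape_write_left :
    ((listTape e [] r).move .left).write (some (e x)) = listTape e [] (x :: r) := by
  simp only [listTape, Tape.move_left_mk', Tape.write_mk']
  rfl

@[simp] theorem listTape_write_none_left :
    ((listTape e [] r).move .left).write none = (listTape e [] r).move .left := by
  simpa only [listTape_head_left_nil] using ((listTape e [] r).move .left).write_self

@[simp] theorem listTape_write_none_nil : (listTape e l []).write none = listTape e l [] := by
  simpa only [listTape_head_nil] using (listTape e l []).write_self

@[simp] theorem listTape_erase_right :
    ((listTape e [] (x :: r)).write none).move .right = listTape e [] r := by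
  simp only [listTape, List.map_cons, ← ListBlank.cons_mk, Tape.write_mk', Tape.move_right_mk',
    ListBlank.head_cons, ListBlank.tail_cons, List.map_nil]
  rw [ListBlank.cons_mk, listBlank_mk_singleton_none]

@[simp] theorem listTape_erase : (listTape e l [x]).write none = listTape e l [] := by
  simp only [listTape, List.map_cons, ← ListBlank.cons_mk, Tape.write_mk', List.map_nil,
    ListBlank.tail_cons]
  rw [ListBlank.cons_mk, listBlank_mk_singleton_none]

theorem listTape_left_injective (he : Function.Injective e) :
    Function.Injective fun l => listTape e l r := by
  intro l l' h
  have hget (i : ℕ) : (l.map fun x => some (e x)).getI i = (l'.map fun x => some (e x)).getI i :=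
    congrArg (fun T : Tape (Option β) => T.left.nth i) h
  refine List.ext_getElem? fun i => Option.map_injective (Option.some_injective β |>.comp he) ?_
  have hi := hget i
  rw [List.getI_eq_getElem?_getD, List.getI_eq_getElem?_getD, List.getElem?_map,
    List.getElem?_map] at hi
  rcases hl : l[i]? with _ | a <;> rcases hl' : l'[i]? with _ | b <;> simp_all

end ListTape

/-- Write a letter on a tape, then move its head. -/
def writeMove {β : Type*} (T : Turing.Tape (Option β)) (p : Option β × Option Turing.Dir) :
    Turing.Tape (Option β) :=
  match p.2 with
  | none => T.write p.1
  | some d => (T.write p.1).move d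

end TimeComplexity

namespace Thompson

open TimeComplexity

/-! ### The machine -/

/-- Words of length at most `B`; the machine keeps such words in its finite control. -/
abbrev BoundedWord (B : ℕ) : Type := {u : Word // u.length ≤ B}

instance (B : ℕ) : Finite (BoundedWord B) := List.finite_length_le Bool B

/-- Truncation to length `B`. It makes the transition function total; the machine only keeps words
that are short enough. -/
def BoundedWord.trunc (B : ℕ) (u : Word) : BoundedWord B := ⟨u.take B, List.length_take_le _ _⟩

theorem BoundedWord.val_trunc {B : ℕ} {u : Word} (hu : u.length ≤ B) : (trunc B u).1 = u :=
  List.take_of_length_le hu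

/-- The states of the machine. -/
inductive State (Γ : Type) (B : ℕ)
  /-- Read the next input letter. -/
  | next
  /-- Apply the map of the letter `a`; the word `p` has been popped from the stack. -/
  | pop (a : Γ) (p : BoundedWord B)
  /-- Push the letters of `v` on the stack. -/
  | push (v : BoundedWord B)
  | rewindInput
  /-- Rewind the guess, and then apply all maps `again`, or compare the guess with the stack. -/
  | rewindGuess (again : Bool)
  | compare
  /-- Pass to the next guess in lexicographic order. -/
  | increment
  /-- The machine has stopped, all words that have been tried are fixed. -/
  | fixed
  /-- The machine has stopped at a word that is not fixed. -/
  | moved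

instance (Γ : Type) [Finite Γ] (B : ℕ) : Finite (State Γ B) := by
  refine Set.finite_univ_iff.1 (Set.Finite.subset (s := Set.range (fun q : Γ × _ => .pop q.1 q.2) ∪
    Set.range .push ∪ Set.range .rewindGuess ∪
    {.next, .rewindInput, .compare, .increment, .fixed, .moved}) (Set.toFinite _) ?_)
  rintro (_ | _) - <;> simp

/-- The tapes of the machine: a cell holds an input letter, a letter of a word, or the blank. -/
abbrev MachineTape (Γ : Type) : Type := Turing.Tape (Option (Γ ⊕ Bool))

section Machine

variable {Γ : Type} {B : ℕ}

open Classical in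
/-- The transitions. Tape `0` holds the input, tape `1` the guess, and tape `2` a stack with the
image of the guess. A letter that is missing on the stack is read from the guess, and a letter that
is missing there is chosen from `choice`. If the stack and the guess agree in the end, then the
machine tries the next guess (`search = true`) or stops. -/
def trans (f : Γ → Word ≃. Word) (choice : Set Bool) (search : Bool) :
    State Γ B → (Fin 3 → Option (Γ ⊕ Bool)) →
      Set (State Γ B × (Fin 3 → Option (Γ ⊕ Bool) × Option Turing.Dir))
  | .next, h => match h 0 with
    | some (.inl a) => {(.pop a (.trunc B []), ![(h 0, some .right), (h 1, none), (h 2, none)])}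
    | _ => {(.rewindInput, ![(h 0, some .left), (h 1, none), (h 2, none)])}
  | .pop a p, h => match f a p.1 with
    | some v => {(.push (.trunc B v.reverse), ![(h 0, none), (h 1, none), (h 2, some .left)])}
    | none => match h 2 with
      | some (.inr b) =>
        {(.pop a (.trunc B (p.1 ++ [b])), ![(h 0, none), (h 1, none), (none, some .right)])}
      | _ => match h 1 with
        | some (.inr b) =>
          {(.pop a (.trunc B (p.1 ++ [b])), ![(h 0, none), (h 1, some .right), (h 2, none)])}
        | _ => {r | ∃ b ∈ choice, r = (.pop a (.trunc B (p.1 ++ [b])),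
            ![(h 0, none), (some (.inr b), some .right), (h 2, none)])}
  | .push v, h => match v.1 with
    | [] => {(.next, ![(h 0, none), (h 1, none), (h 2, some .right)])}
    | b :: v =>
      {(.push (.trunc B v), ![(h 0, none), (h 1, none), (some (.inr b), some .left)])}
  | .rewindInput, h => match h 0 with
    | some _ => {(.rewindInput, ![(h 0, some .left), (h 1, none), (h 2, none)])}
    | none => {(.rewindGuess false, ![(h 0, some .right), (h 1, some .left), (h 2, none)])}
  | .rewindGuess again, h => match h 1 with
    | some _ => {(.rewindGuess again, ![(h 0, none), (h 1, some .left), (h 2, none)])}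
    | none => {(bif again then .next else .compare,
        ![(h 0, none), (h 1, some .right), (h 2, none)])}
  | .compare, h =>
    if h 1 = h 2 then match h 1 with
      | some _ => {(.compare, ![(h 0, none), (h 1, some .right), (none, some .right)])}
      | none => {(bif search then .increment else .fixed,
          ![(h 0, none), (h 1, some .left), (h 2, none)])}
    else {(.moved, ![(h 0, none), (h 1, none), (h 2, none)])}
  | .increment, h => match h 1 with
    | some (.inr true) => {(.increment, ![(h 0, none), (none, some .left), (h 2, none)])}
    | some (.inr false) =>
      {(.rewindGuess true, ![(h 0, none), (some (.inr true), some .left), (h 2, none)])}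
    | _ => {(.fixed, ![(h 0, none), (h 1, none), (h 2, none)])}
  | .fixed, _ => ∅
  | .moved, _ => ∅

/-- The machine with the transitions `trans f choice search`. -/
noncomputable def machine [Finite Γ] (f : Γ → Word ≃. Word) (B : ℕ) (choice : Set Bool)
    (search : Bool) (accept : Set (State Γ B)) : Machine Γ where
  workTapes := 2
  State := State Γ B
  stateFintype := Fintype.ofFinite _
  Aux := Bool
  auxFintype := inferInstance
  start := .next
  accept := accept
  trans := trans f choice search

theorem trans_subsingleton (f : Γ → Word ≃. Word) (b search : Bool) (q : State Γ B)
    (h : Fin 3 → Option (Γ ⊕ Bool)) : (trans f {b} search q h).Subsingleton := by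
  cases q <;> simp only [trans] <;> repeat' split
  all_goals first
    | exact Set.subsingleton_singleton
    | exact Set.subsingleton_empty
    | (rintro _ ⟨_, rfl, rfl⟩ _ ⟨_, rfl, rfl⟩; rfl)

theorem trans_mono {choice choice' : Set Bool} (hc : choice ⊆ choice') (f : Γ → Word ≃. Word)
    (search : Bool) (q : State Γ B) (h : Fin 3 → Option (Γ ⊕ Bool)) :
    trans f choice search q h ⊆ trans f choice' search q h := by
  cases q <;> simp only [trans] <;> repeat' split
  all_goals first
    | exact subset_rfl
    | exact fun r ⟨b, hb, hr⟩ => ⟨b, hc hb, hr⟩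

/-- A configuration of the machine, with named tapes. -/
structure Conf (Γ : Type) (B : ℕ) where
  state : State Γ B
  input : MachineTape Γ
  guess : MachineTape Γ
  stack : MachineTape Γ

/-- The steps of the machine. Here the letters to be chosen may depend on the tape with the guess,
so that a function `choice` is a strategy for the nondeterministic choices. -/
def Conf.Step (f : Γ → Word ≃. Word) (choice : MachineTape Γ → Set Bool) (search : Bool)
    (c c' : Conf Γ B) : Prop :=
  ∃ r ∈ trans f (choice c.guess) search c.state ![c.input.head, c.guess.head, c.stack.head],
    c' = ⟨r.1, writeMove c.input (r.2 0), writeMove c.guess (r.2 1), writeMove c.stack (r.2 2)⟩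

/-- The configuration `c` as a configuration of `machine f B choice search accept`. -/
noncomputable def Conf.toCfg [Finite Γ] (f : Γ → Word ≃. Word) (choice : Set Bool) (search : Bool)
    (accept : Set (State Γ B)) (c : Conf Γ B) : (machine f B choice search accept).Cfg where
  state := c.state
  tape := ![c.input, c.guess, c.stack]

theorem realizes_step [Finite Γ] (f : Γ → Word ≃. Word) (choice : Set Bool) (search : Bool)
    (accept : Set (State Γ B)) :
    (machine f B choice search accept).Realizes (Conf.Step f (fun _ => choice) search)
      (Conf.toCfg f choice search accept) := by
  intro c d
  have hhead : (fun i => ((c.toCfg f choice search accept).tape i).head) =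
      ![c.input.head, c.guess.head, c.stack.head] := by
    funext (i : Fin 3)
    fin_cases i <;> rfl
  have htape (r : State Γ B × (Fin 3 → Option (Γ ⊕ Bool) × Option Turing.Dir)) :
      (fun i => (machine f B choice search accept).writeMove
        ((c.toCfg f choice search accept).tape i) (r.2 i)) =
      ![writeMove c.input (r.2 0), writeMove c.guess (r.2 1), writeMove c.stack (r.2 2)] := by
    funext (i : Fin 3)
    fin_cases i <;> rfl
  unfold Machine.Step
  rw [hhead]
  constructor
  · rintro ⟨r, hr, rfl⟩
    exact ⟨_, ⟨r, hr, rfl⟩, congrArg (Machine.Cfg.mk r.1) (htape r)⟩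
  · rintro ⟨_, ⟨r, hr, rfl⟩, rfl⟩
    refine ⟨r, hr, ?_⟩
    exact (congrArg (Machine.Cfg.mk r.1) (htape r)).symm

/-- The configuration in which the word `p` has been guessed and no letter has been read. -/
def Conf.start (w : List Γ) (p : Word) : Conf Γ B :=
  ⟨.next, listTape Sum.inl [] w, listTape Sum.inr [] p, listTape Sum.inr [] []⟩

theorem init_machine [Finite Γ] (f : Γ → Word ≃. Word) (choice : Set Bool) (search : Bool)
    (accept : Set (State Γ B)) (w : List Γ) :
    (machine f B choice search accept).init w =
      Conf.toCfg f choice search accept (.start w []) := by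
  refine congrArg (Machine.Cfg.mk _) ?_
  funext (i : Fin 3)
  fin_cases i <;> rfl

namespace Conf

variable {f : Γ → Word ≃. Word} {choice : MachineTape Γ → Set Bool} {search : Bool}
  {I G S : MachineTape Γ} {c : Conf Γ B} {a : Γ} {p : BoundedWord B} {l r : List Γ}
  {gl gr s v : Word} {b : Bool}

theorem step_next_cons : Step f choice search ⟨.next, listTape Sum.inl l (a :: r), G, S⟩ c ↔
    c = ⟨.pop a (.trunc B []), listTape Sum.inl (a :: l) r, G, S⟩ := by
  simp [Step, trans, writeMove]

theorem step_next_nil : Step f choice search ⟨.next, listTape Sum.inl l [], G, S⟩ c ↔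
    c = ⟨.rewindInput, (listTape Sum.inl l []).move .left, G, S⟩ := by
  simp [Step, trans, writeMove]

theorem step_pop_of_mem (hv : v ∈ f a p.1) : Step f choice search ⟨.pop a p, I, G, S⟩ c ↔
    c = ⟨.push (.trunc B v.reverse), I, G, S.move .left⟩ := by
  simp [Step, trans, writeMove, Option.mem_def.1 hv]

theorem step_pop_stack (hp : f a p.1 = none) :
    Step f choice search ⟨.pop a p, I, G, listTape Sum.inr [] (b :: s)⟩ c ↔
      c = ⟨.pop a (.trunc B (p.1 ++ [b])), I, G, listTape Sum.inr [] s⟩ := by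
  simp [Step, trans, writeMove, hp]

theorem step_pop_guess (hp : f a p.1 = none) :
    Step f choice search ⟨.pop a p, I, listTape Sum.inr gl (b :: gr), listTape Sum.inr [] []⟩ c ↔
      c = ⟨.pop a (.trunc B (p.1 ++ [b])), I, listTape Sum.inr (b :: gl) gr,
        listTape Sum.inr [] []⟩ := by
  simp [Step, trans, writeMove, hp]

theorem step_pop_choice (hp : f a p.1 = none) :
    Step f choice search ⟨.pop a p, I, listTape Sum.inr gl [], listTape Sum.inr [] []⟩ c ↔
      ∃ b ∈ choice (listTape Sum.inr gl []), c = ⟨.pop a (.trunc B (p.1 ++ [b])), I,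
        listTape Sum.inr (b :: gl) [], listTape Sum.inr [] []⟩ := by
  simp [Step, trans, writeMove, hp, or_and_right, exists_or, and_assoc]

theorem step_push_nil (hv : p.1 = []) : Step f choice search ⟨.push p, I, G, S⟩ c ↔
    c = ⟨.next, I, G, S.move .right⟩ := by
  simp [Step, trans, writeMove, hv]

theorem step_push_cons (hv : p.1 = b :: v) :
    Step f choice search ⟨.push p, I, G, (listTape Sum.inr [] s).move .left⟩ c ↔
      c = ⟨.push (.trunc B v), I, G, (listTape Sum.inr [] (b :: s)).move .left⟩ := by
  simp [Step, trans, writeMove, hv]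

theorem step_rewindInput_cons :
    Step f choice search ⟨.rewindInput, (listTape Sum.inl (a :: l) r).move .left, G, S⟩ c ↔
      c = ⟨.rewindInput, (listTape Sum.inl l (a :: r)).move .left, G, S⟩ := by
  simp [Step, trans, writeMove]

theorem step_rewindInput_nil :
    Step f choice search ⟨.rewindInput, (listTape Sum.inl [] r).move .left, G, S⟩ c ↔
      c = ⟨.rewindGuess false, listTape Sum.inl [] r, G.move .left, S⟩ := by
  simp [Step, trans, writeMove]

variable {again : Bool}

theorem step_rewindGuess_cons :
    Step f choice search ⟨.rewindGuess again, I, (listTape Sum.inr (b :: gl) gr).move .left, S⟩ c ↔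
      c = ⟨.rewindGuess again, I, (listTape Sum.inr gl (b :: gr)).move .left, S⟩ := by
  simp [Step, trans, writeMove]

theorem step_rewindGuess_nil :
    Step f choice search ⟨.rewindGuess again, I, (listTape Sum.inr [] gr).move .left, S⟩ c ↔
      c = ⟨bif again then .next else .compare, I, listTape Sum.inr [] gr, S⟩ := by
  simp [Step, trans, writeMove]

theorem step_compare_ne (h : G.head ≠ S.head) :
    Step f choice search ⟨.compare, I, G, S⟩ c ↔ c = ⟨.moved, I, G, S⟩ := by
  simp [Step, trans, writeMove, h]

theorem step_compare_cons :
    Step f choice search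
      ⟨.compare, I, listTape Sum.inr gl (b :: gr), listTape Sum.inr [] (b :: s)⟩ c ↔
      c = ⟨.compare, I, listTape Sum.inr (b :: gl) gr, listTape Sum.inr [] s⟩ := by
  simp [Step, trans, writeMove]

theorem step_compare_nil :
    Step f choice search ⟨.compare, I, listTape Sum.inr gl [], listTape Sum.inr [] []⟩ c ↔
      c = ⟨bif search then .increment else .fixed, I, (listTape Sum.inr gl []).move .left,
        listTape Sum.inr [] []⟩ := by
  simp [Step, trans, writeMove]

theorem step_increment_true :
    Step f choice search
      ⟨.increment, I, (listTape Sum.inr (true :: gl) []).move .left, S⟩ c ↔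
      c = ⟨.increment, I, (listTape Sum.inr gl []).move .left, S⟩ := by
  simp [Step, trans, writeMove]

theorem step_increment_false :
    Step f choice search
      ⟨.increment, I, (listTape Sum.inr (false :: gl) []).move .left, S⟩ c ↔
      c = ⟨.rewindGuess true, I, (listTape Sum.inr gl [true]).move .left, S⟩ := by
  simp [Step, trans, writeMove]

theorem step_increment_nil :
    Step f choice search ⟨.increment, I, (listTape Sum.inr [] []).move .left, S⟩ c ↔
      c = ⟨.fixed, I, (listTape Sum.inr [] []).move .left, S⟩ := by
  simp [Step, trans, writeMove]

theorem not_step (h : c.state = .fixed ∨ c.state = .moved) (c' : Conf Γ B) :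
    ¬ Step f choice search c c' := by
  rcases h with h | h <;> simp [Step, h, trans]

theorem step_mono {choice' : MachineTape Γ → Set Bool} (h : choice ≤ choice') :
    Step (B := B) f choice search ≤ Step f choice' search :=
  fun c _ ⟨r, hr, hc⟩ => ⟨r, trans_mono (h c.guess) f search _ _ hr, hc⟩

end Conf

/-! ### The runs of the machine -/

/-- As long as the guess does not belong to `D`, the strategy `choice` offers letters by which it
may be extended, and all of them preserve the invariant `Inv`. -/
structure IsStrategy (choice : MachineTape Γ → Set Bool) (D Inv : Set Word) : Prop where
  nonempty : ∀ x ∈ Inv, x ∉ D → (choice (listTape Sum.inr x.reverse [])).Nonempty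
  concat_mem : ∀ x ∈ Inv, x ∉ D → ∀ b ∈ choice (listTape Sum.inr x.reverse []), x ++ [b] ∈ Inv

theorem IsStrategy.mono {choice : MachineTape Γ → Set Bool} {D D' Inv : Set Word}
    (h : IsStrategy choice D Inv) (hD : D ⊆ D') : IsStrategy choice D' Inv :=
  ⟨fun x hx hxD => h.nonempty x hx (mt (@hD x) hxD),
    fun x hx hxD => h.concat_mem x hx (mt (@hD x) hxD)⟩

namespace Conf

variable {f : Γ → Word ≃. Word} {K : ℕ} {choice : MachineTape Γ → Set Bool} {Inv : Set Word}
  {search : Bool} {g : Word ≃. Word} {I S : MachineTape Γ} {a : Γ} {w l r : List Γ}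
  {gl gr s p : Word}

theorem within_pop_none (hg : IsRightIdealIso g) {p : BoundedWord B} (hp : f a p.1 = none)
    (hchoice : IsStrategy choice (dom (g.trans (f a))) Inv) (hs : p.1 ++ s ∈ g gl.reverse)
    (hInv : gl.reverse ++ gr ∈ Inv) :
    Within (Step f choice search)
      (fun c => ∃ b gl' gr' s', c = ⟨.pop a (.trunc B (p.1 ++ [b])), I, listTape Sum.inr gl' gr',
        listTape Sum.inr [] s'⟩ ∧ p.1 ++ [b] ++ s' ∈ g gl'.reverse ∧ gl'.reverse ++ gr' ∈ Inv)
      1 ⟨.pop a p, I, listTape Sum.inr gl gr, listTape Sum.inr [] s⟩ := by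
  rcases s with _ | ⟨b, s⟩
  · have hs' (b : Bool) : p.1 ++ [b] ++ [] ∈ g (b :: gl).reverse := by
      simpa using hg.map_append _ _ hs [b]
    rcases gr with _ | ⟨b, gr⟩
    · rw [List.append_nil] at hs hInv
      have hdom : gl.reverse ∉ dom (g.trans (f a)) := by
        rw [mem_dom_trans_iff hs]
        rintro ⟨v, hv⟩
        simp [hp] at hv
      refine .step ?_ fun c hc => ?_
      · obtain ⟨b, hb⟩ := hchoice.nonempty _ hInv hdom
        rw [List.reverse_reverse] at hb
        exact ⟨_, (step_pop_choice hp).2 ⟨b, hb, rfl⟩⟩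
      · obtain ⟨b, hb, rfl⟩ := (step_pop_choice hp).1 hc
        rw [← gl.reverse_reverse] at hb
        exact .here ⟨b, _, _, _, rfl, hs' b, by simpa using hchoice.concat_mem _ hInv hdom b hb⟩
    · exact .of_unique_step (fun _ => step_pop_guess hp)
        (.here ⟨b, _, _, _, rfl, hs' b, by simpa using hInv⟩)
  · exact .of_unique_step (fun _ => step_pop_stack hp)
      (.here ⟨b, _, _, _, rfl, by simpa using hs, hInv⟩)

theorem within_pop (hf : IsTableFamily f K B) (hg : IsRightIdealIso g)
    (hchoice : IsStrategy choice (dom (g.trans (f a))) Inv) {p : BoundedWord B} {n : ℕ}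
    (hp : p.1.length ≤ K) (hn : K ≤ p.1.length + n) (hs : p.1 ++ s ∈ g gl.reverse)
    (hInv : gl.reverse ++ gr ∈ Inv) :
    Within (Step f choice search)
      (fun c => ∃ v gl' gr' s', c = ⟨.push (.trunc B v.reverse), I, listTape Sum.inr gl' gr',
        (listTape Sum.inr [] s').move .left⟩ ∧ v.length ≤ B ∧
        v ++ s' ∈ g.trans (f a) gl'.reverse ∧ gl'.reverse ++ gr' ∈ Inv)
      (n + 1) ⟨.pop a p, I, listTape Sum.inr gl gr, listTape Sum.inr [] s⟩ := by
  induction n using Nat.strong_induction_on generalizing p gl gr s with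
  | h n ih =>
    rcases hv : f a p.1 with _ | v
    · have hpK : p.1.length < K := by
        by_contra! hK
        obtain ⟨v, hv'⟩ := hf.mem_dom a p.1 hK
        simp [hv] at hv'
      obtain ⟨n, rfl⟩ : ∃ m, n = m + 1 := ⟨n - 1, by omega⟩
      rw [add_comm]
      refine (within_pop_none hg hv hchoice hs hInv).bind ?_
      rintro _ ⟨b, gl', gr', s', rfl, hs', hInv'⟩
      have hlen : (p.1 ++ [b]).length ≤ K := by simpa using hpK
      have hval := BoundedWord.val_trunc (hlen.trans hf.le)
      refine ih n (Nat.lt_succ_self n) (hval.symm ▸ hlen) ?_ (hval.symm ▸ hs') hInv'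
      rw [hval, List.length_append, List.length_singleton]
      omega
    · exact .of_unique_step (fun _ => step_pop_of_mem hv) <| .here ⟨v, _, _, _, rfl,
        hf.length_le a _ _ hp hv, (PEquiv.mem_trans _ _ _ _).2
          ⟨_, hs, (hf.iso a).map_append _ _ hv s⟩, hInv⟩

theorem within_push {G : MachineTape Γ} {v : Word} (hv : v.length ≤ B) :
    Within (Step f choice search)
      (fun c => c = ⟨.next, I, G, listTape Sum.inr [] (v.reverse ++ s)⟩)
      (v.length + 1) ⟨.push (.trunc B v), I, G, (listTape Sum.inr [] s).move .left⟩ := by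
  induction v generalizing s with
  | nil =>
    refine .of_unique_step (fun _ => step_push_nil (BoundedWord.val_trunc hv)) (.here ?_)
    simp
  | cons b v ih =>
    refine .of_unique_step (fun _ => step_push_cons (BoundedWord.val_trunc hv)) ?_
    simpa using ih (s := b :: s) (Nat.le_of_succ_le hv)

theorem within_letter (hf : IsTableFamily f K B) (hg : IsRightIdealIso g)
    (hchoice : IsStrategy choice (dom (g.trans (f a))) Inv) (hs : s ∈ g gl.reverse)
    (hInv : gl.reverse ++ gr ∈ Inv) :
    Within (Step (B := B) f choice search)
      (fun c => ∃ gl' gr' s', c = ⟨.next, listTape Sum.inl (a :: l) r, listTape Sum.inr gl' gr',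
        listTape Sum.inr [] s'⟩ ∧ s' ∈ g.trans (f a) gl'.reverse ∧ gl'.reverse ++ gr' ∈ Inv)
      (2 * B + 3)
      ⟨.next, listTape Sum.inl l (a :: r), listTape Sum.inr gl gr, listTape Sum.inr [] s⟩ := by
  have hpop := within_pop (I := listTape Sum.inl (a :: l) r) (search := search) (n := K) hf hg
    hchoice (p := .trunc B []) (by simp [BoundedWord.trunc]) (by simp)
    (by simpa [BoundedWord.trunc] using hs) hInv
  refine .of_unique_step (fun _ => step_next_cons) <|
    (hpop.bind (t := B + 1) ?_).mono (by linarith [hf.le])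
  rintro _ ⟨v, gl', gr', s', rfl, hvB, hv, hInv'⟩
  rw [← v.length_reverse] at hvB
  refine ((within_push hvB).mono (Nat.add_le_add_right hvB 1)).imp ?_
  rintro _ rfl
  exact ⟨gl', gr', _, rfl, by simpa using hv, hInv'⟩

theorem within_apply (hf : IsTableFamily f K B)
    (hchoice : IsStrategy choice (dom (composite f w)) Inv) (hw : w = l.reverse ++ r)
    (hs : s ∈ composite f l.reverse gl.reverse) (hInv : gl.reverse ++ gr ∈ Inv) :
    Within (Step (B := B) f choice search)
      (fun c => ∃ gl' gr' s', c = ⟨.next, listTape Sum.inl w.reverse [], listTape Sum.inr gl' gr',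
        listTape Sum.inr [] s'⟩ ∧ s' ∈ composite f w gl'.reverse ∧ gl'.reverse ++ gr' ∈ Inv)
      (r.length * (2 * B + 3))
      ⟨.next, listTape Sum.inl l r, listTape Sum.inr gl gr, listTape Sum.inr [] s⟩ := by
  induction r generalizing l gl gr s with
  | nil =>
    subst hw
    exact .here ⟨gl, gr, s, by simp, by simpa using hs, hInv⟩
  | cons a r ih =>
    have hcomp : composite f w = ((composite f l.reverse).trans (f a)).trans (composite f r) := by
      rw [hw, composite_append, composite, PEquiv.trans_assoc]
    have hdom : dom (composite f w) ⊆ dom ((composite f l.reverse).trans (f a)) := by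
      rintro u ⟨z, hz⟩
      rw [hcomp, PEquiv.mem_trans] at hz
      exact hz.imp fun _ => And.left
    rw [List.length_cons, add_one_mul, add_comm]
    refine (within_letter hf (hf.composite_iso _) (hchoice.mono hdom) hs hInv).bind ?_
    rintro _ ⟨gl', gr', s', rfl, hs', hInv'⟩
    refine ih (by simpa using hw) ?_ hInv'
    simpa [composite_append, composite] using hs'

theorem within_rewindInput {G : MachineTape Γ} :
    Within (Step (B := B) f choice search)
      (fun c => c = ⟨.rewindGuess false, listTape Sum.inl [] (l.reverse ++ r), G.move .left, S⟩)
      (l.length + 1) ⟨.rewindInput, (listTape Sum.inl l r).move .left, G, S⟩ := by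
  induction l generalizing r with
  | nil => exact .of_unique_step (fun _ => step_rewindInput_nil) (.here rfl)
  | cons a l ih =>
    refine .of_unique_step (fun _ => step_rewindInput_cons) ?_
    simpa using ih (r := a :: r)

theorem within_rewindGuess {again : Bool} :
    Within (Step (B := B) f choice search)
      (fun c => c = ⟨bif again then .next else .compare, I,
        listTape Sum.inr [] (gl.reverse ++ gr), S⟩)
      (gl.length + 1) ⟨.rewindGuess again, I, (listTape Sum.inr gl gr).move .left, S⟩ := by
  induction gl generalizing gr with
  | nil => exact .of_unique_step (fun _ => step_rewindGuess_nil) (.here rfl)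
  | cons b gl ih =>
    refine .of_unique_step (fun _ => step_rewindGuess_cons) ?_
    simpa using ih (gr := b :: gr)

theorem within_rewind :
    Within (Step (B := B) f choice search)
      (fun c => c = ⟨.compare, listTape Sum.inl [] w, listTape Sum.inr [] gl.reverse, S⟩)
      (1 + (w.length + 1 + (gl.length + 1)))
      ⟨.next, listTape Sum.inl w.reverse [], listTape Sum.inr gl [], S⟩ := by
  rw [add_comm 1]
  refine .of_unique_step (fun _ => step_next_nil) ?_
  rw [← w.length_reverse]
  refine within_rewindInput.bind ?_
  rintro _ rfl
  simpa using within_rewindGuess (gr := []) (again := false)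

theorem within_compare :
    Within (Step (B := B) f choice search)
      (fun c => (s = gr ∧ c = ⟨bif search then .increment else .fixed, I,
          (listTape Sum.inr (gr.reverse ++ gl) []).move .left, listTape Sum.inr [] []⟩) ∨
        (s ≠ gr ∧ c.state = .moved))
      (gr.length + 1) ⟨.compare, I, listTape Sum.inr gl gr, listTape Sum.inr [] s⟩ := by
  induction gr generalizing gl s with
  | nil =>
    rcases s with _ | ⟨b', s⟩
    · exact .of_unique_step (fun _ => step_compare_nil) (.here (.inl ⟨rfl, rfl⟩))
    · exact .of_unique_step (fun _ => step_compare_ne (by simp)) (.here (.inr ⟨by simp, rfl⟩))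
  | cons b gr ih =>
    rcases s with _ | ⟨b', s⟩
    · exact .of_unique_step (fun _ => step_compare_ne (by simp)) (.here (.inr ⟨by simp, rfl⟩))
    · obtain rfl | hb := eq_or_ne b b'
      · refine .of_unique_step (fun _ => step_compare_cons) ?_
        simpa using ih (gl := b :: gl) (s := s)
      · exact (Within.of_unique_step (t := 0) (fun _ => step_compare_ne (by simpa using hb))
          (.here (.inr ⟨by simp [hb.symm], rfl⟩))).mono (by simp)

theorem within_pass (hf : IsTableFamily f K B)
    (hchoice : IsStrategy choice (dom (composite f w)) Inv)
    (hInv : Inv ⊆ {u | NoProperPrefix (dom (composite f w)) u}) (hp : p ∈ Inv) :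
    Within (Step f choice search)
      (fun c : Conf Γ B => ∃ u ∈ prefixCode (dom (composite f w)), u ∈ Inv ∧
        ((u ∈ composite f w u ∧ c = ⟨bif search then .increment else .fixed, listTape Sum.inl [] w,
          (listTape Sum.inr u.reverse []).move .left, listTape Sum.inr [] []⟩) ∨
        (u ∉ composite f w u ∧ c.state = .moved)))
      ((2 * B + 2 * K + 4) * w.length + 4) (start w p) := by
  have happly := within_apply (search := search) (l := []) (gl := []) (s := []) hf hchoice rfl
    (by simp [composite]) hp
  refine (happly.bind (t := (2 * K + 1) * w.length + 4) ?_).mono (by linarith)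
  rintro _ ⟨gl, gr, s, rfl, hs, hgl⟩
  obtain rfl : gr = [] := by
    simpa using hInv hgl _ ⟨s, hs⟩ (List.prefix_append _ _)
  rw [List.append_nil] at hgl
  have hlen : gl.length ≤ K * w.length := by
    simpa using (hInv hgl).length_le (hf.mem_dom_composite w)
  have hcode : gl.reverse ∈ prefixCode (dom (composite f w)) := ⟨⟨s, hs⟩, hInv hgl⟩
  refine (within_rewind.bind (t := gl.length + 1) ?_).mono (by linarith)
  rintro _ rfl
  rw [← gl.length_reverse]
  refine within_compare.imp ?_
  rintro c (⟨rfl, rfl⟩ | ⟨hne, hc⟩)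
  · exact ⟨_, hcode, hgl, .inl ⟨hs, by simp⟩⟩
  · exact ⟨_, hcode, hgl, .inr ⟨fun h => hne (Option.mem_unique hs h), hc⟩⟩

theorem within_increment :
    Within (Step (B := B) f choice search)
      (fun c => (∃ q n, gl.reverse = q ++ false :: List.replicate n true ∧
          c = ⟨.next, I, listTape Sum.inr [] (q ++ [true]), S⟩) ∨
        ((∃ n, gl.reverse = List.replicate n true) ∧ c.state = .fixed))
      (gl.length + 2) ⟨.increment, I, (listTape Sum.inr gl []).move .left, S⟩ := by
  induction gl with
  | nil => exact .of_unique_step (fun _ => step_increment_nil) (.here (.inr ⟨⟨0, rfl⟩, rfl⟩))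
  | cons b gl ih =>
    cases b with
    | false =>
      refine .of_unique_step (fun _ => step_increment_false)
        ((within_rewindGuess.mono (by simp)).imp ?_)
      rintro _ rfl
      exact .inl ⟨gl.reverse, 0, by simp, rfl⟩
    | true =>
      refine .of_unique_step (fun _ => step_increment_true) (ih.imp ?_)
      rintro c (⟨q, n, hq, hc⟩ | ⟨⟨n, hn⟩, hc⟩)
      · exact .inl ⟨q, n + 1, by simp [hq, List.replicate_succ'], hc⟩
      · exact .inr ⟨⟨n + 1, by simp [hn, List.replicate_succ']⟩, hc⟩

theorem isStrategy_false (D : Set Word) (p : Word) :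
    IsStrategy (Γ := Γ) (fun _ => {false}) D
      {x | NoProperPrefix D x ∧ ∀ v ∈ prefixCode D, x ≤ v ↔ p ≤ v} where
  nonempty _ _ _ := Set.singleton_nonempty _
  concat_mem := by
    rintro x ⟨hx, hxp⟩ hxD _ rfl
    refine ⟨hx.concat hxD false, fun v hv => ?_⟩
    have hne : x ≠ v := fun h => hxD (h ▸ hv.1)
    rw [← hxp v hv, ← not_lt, lt_concat_false_iff, not_le, hne.le_iff_lt]

/-- No code word is skipped if the guess is only extended by the letter `false`, so the pass from
`p` arrives at the least code word `u` that is not smaller than `p`. -/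
theorem within_lap (hf : IsTableFamily f K B) (hp : NoProperPrefix (dom (composite f w)) p) :
    Within (Step f (fun _ => {false}) true)
      (fun c : Conf Γ B => ∃ u ∈ prefixCode (dom (composite f w)),
        (∀ v ∈ prefixCode (dom (composite f w)), u ≤ v ↔ p ≤ v) ∧
        ((u ∉ composite f w u ∧ c.state = .moved) ∨ (u ∈ composite f w u ∧
          ((c.state = .fixed ∧ ∀ v ∈ prefixCode (dom (composite f w)), v ≤ u) ∨
            ∃ p', NoProperPrefix (dom (composite f w)) p' ∧ c = start w p' ∧
              ∀ v ∈ prefixCode (dom (composite f w)), p' ≤ v ↔ u < v))))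
      ((2 * B + 3 * K + 4) * w.length + 6) (start w p) := by
  have hpass := within_pass (search := true) hf (isStrategy_false _ p) (fun _ => And.left)
    ⟨hp, fun _ _ => Iff.rfl⟩
  refine (hpass.bind (t := K * w.length + 2) ?_).mono (by linarith)
  rintro c ⟨u, hu, ⟨-, hup⟩, ⟨hfix, rfl⟩ | hmoved⟩
  · have hlen : u.reverse.length ≤ K * w.length := by
      simpa using hu.2.length_le (hf.mem_dom_composite w)
    refine (within_increment.mono (Nat.add_le_add_right hlen 2)).imp ?_
    rw [List.reverse_reverse]
    rintro c (⟨q, n, rfl, rfl⟩ | ⟨⟨n, rfl⟩, hc⟩)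
    · refine ⟨_, hu, hup, .inr ⟨hfix, .inr ⟨_, hu.2.sibling (b := false) ?_ true, rfl,
        fun v hv => ?_⟩⟩⟩
      · exact (List.prefix_append_right_inj q).2 (List.prefix_append [false] _)
      · exact concat_true_le_iff fun h => (hv.2 _ hu.1 h).symm
    · refine ⟨_, hu, hup, .inr ⟨hfix, .inl ⟨hc, fun v hv => not_lt.1 fun h => h.ne ?_⟩⟩⟩
      exact hv.2 _ hu.1 (replicate_true_prefix_of_lt h)
  · exact .here ⟨u, hu, hup, .inl hmoved⟩

theorem within_search (hf : IsTableFamily f K B) {N : ℕ}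
    (hp : NoProperPrefix (dom (composite f w)) p)
    (hlt : ∀ v ∈ prefixCode (dom (composite f w)), v < p → v ∈ composite f w v)
    (hN : {v ∈ prefixCode (dom (composite f w)) | p ≤ v}.ncard ≤ N) :
    Within (Step f (fun _ => {false}) true)
      (fun c : Conf Γ B => (c.state = .fixed ∧ composite f w ≤ PEquiv.refl Word) ∨
        (c.state = .moved ∧ ¬ composite f w ≤ PEquiv.refl Word))
      ((N + 1) * ((2 * B + 3 * K + 4) * w.length + 6)) (start w p) := by
  rw [(hf.composite_iso w).le_refl_iff]
  induction N using Nat.strong_induction_on generalizing p with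
  | h N ih =>
    rw [add_comm, add_mul, one_mul]
    refine (within_lap hf hp).bind ?_
    rintro c ⟨u, hu, hup, ⟨hmoved, hc⟩ | ⟨hfix, hc⟩⟩
    · exact .here (.inr ⟨hc, fun h => hmoved (h u hu)⟩)
    have hle (v : Word) (hv : v ∈ prefixCode (dom (composite f w))) (hvu : v ≤ u) :
        v ∈ composite f w v := by
      rcases hvu.eq_or_lt with rfl | hvu
      · exact hfix
      · exact hlt v hv (not_le.1 fun h => hvu.not_ge ((hup v hv).2 h))
    rcases hc with ⟨hc, hmax⟩ | ⟨p', hp', rfl, hp'u⟩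
    · exact .here (.inl ⟨hc, fun v hv => hle v hv (hmax v hv)⟩)
    have hcard : {v ∈ prefixCode (dom (composite f w)) | p' ≤ v}.ncard < N := by
      refine (Set.ncard_lt_ncard ⟨fun v hv => ?_, fun h => ?_⟩ ?_).trans_le hN
      · exact ⟨hv.1, (hup v hv.1).1 ((hp'u v hv.1).1 hv.2).le⟩
      · exact lt_irrefl u ((hp'u u hu).1 (h ⟨hu, (hup u hu).1 le_rfl⟩).2)
      · exact (finite_prefixCode (hf.mem_dom_composite w)).subset fun _ => And.left
    obtain ⟨m, rfl⟩ : ∃ m, N = m + 1 := ⟨N - 1, by omega⟩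
    refine ih m (Nat.lt_succ_self m) hp' (fun v hv h => hle v hv ?_) (Nat.le_of_lt_succ hcard)
    exact not_lt.1 fun h' => h.not_ge ((hp'u v hv).2 h')

/-- The strategy that guesses the word `u`. -/
def guided (u : Word) (T : MachineTape Γ) : Set Bool :=
  {b | ∃ x, T = listTape Sum.inr x.reverse [] ∧ x ++ [b] <+: u}

theorem isStrategy_guided {D : Set Word} {u : Word} (hu : u ∈ D) :
    IsStrategy (Γ := Γ) (guided u) D {x | NoProperPrefix D x ∧ x <+: u} where
  nonempty := by
    rintro x ⟨-, _ | ⟨b, t⟩, rfl⟩ hxD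
    · exact absurd (by simpa using hu) hxD
    · exact ⟨b, x, rfl, t, by simp⟩
  concat_mem := by
    rintro x ⟨hx, -⟩ hxD b ⟨y, hxy, hy⟩
    obtain rfl : x = y :=
      List.reverse_injective (listTape_left_injective _ Sum.inr_injective hxy)
    exact ⟨hx.concat hxD b, hy⟩

theorem within_moved (hf : IsTableFamily f K B) {u : Word}
    (hu : u ∈ prefixCode (dom (composite f w))) (hmoved : u ∉ composite f w u) :
    Within (Step (B := B) f (guided u) false) (fun c => c.state = .moved)
      ((2 * B + 2 * K + 4) * w.length + 4) (start w []) := by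
  refine (within_pass hf (isStrategy_guided hu.1) (fun _ => And.left)
    ⟨noProperPrefix_nil _, List.nil_prefix⟩).imp ?_
  rintro c ⟨v, hv, ⟨-, hvu⟩, ⟨hfix, -⟩ | ⟨-, hc⟩⟩
  · exact absurd (hu.2 v hv.1 hvu ▸ hfix) hmoved
  · exact hc

end Conf

end Machine

/-! ### The complexity of the word problem -/

section Complexity

open Conf

variable {Γ : Type} [Finite Γ] {f : Γ → Word ≃. Word}

theorem composite_le_refl_mem_dTime (hf : ∀ a, IsFGEssentialIso (f a)) :
    {w | composite f w ≤ PEquiv.refl Word} ∈ DTime (fun n => n ^ 2) := by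
  obtain ⟨K, B, hT⟩ := exists_isTableFamily hf
  obtain ⟨D, hD⟩ := hT.exists_encard_prefixCode_le
  have hncard (w : List Γ) :
      {v ∈ prefixCode (dom (composite f w)) | [] ≤ v}.ncard ≤ D * w.length + 1 := by
    have hfin := finite_prefixCode (hT.mem_dom_composite w)
    refine (Set.ncard_le_ncard (fun _ => And.left) hfin).trans ?_
    exact_mod_cast hfin.cast_ncard_eq ▸ hD w
  have hsearch (w : List Γ) := within_search hT (noProperPrefix_nil _)
    (fun v _ hv => absurd hv (List.not_lt_nil v)) (hncard w)
  have hM := realizes_step f {false} true {(.fixed : State Γ B)}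
  have hhalt (w : List Γ) (c : Conf Γ B)
      (hc : (c.state = .fixed ∧ composite f w ≤ PEquiv.refl Word) ∨
        (c.state = .moved ∧ ¬ composite f w ≤ PEquiv.refl Word)) :=
    not_step (f := f) (choice := fun _ => {false}) (search := true) (hc.imp And.left And.left)
  refine ⟨machine f B {false} true {.fixed},
    (D + 2) * (2 * (2 * B + 3 * K + 4) + 6) + (D + 2) * 6,
    fun q h => trans_subsingleton f _ _ q h, fun w t c hc => ?_, fun w => ?_⟩
  · rw [init_machine] at hc
    refine (hM.of_computes (hsearch w) (hhalt w) hc).1.trans ?_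
    generalize 2 * B + 3 * K + 4 = A
    generalize w.length = n
    have hn : n ≤ n ^ 2 := Nat.le_self_pow two_ne_zero n
    nlinarith [Nat.mul_le_mul_left D hn, Nat.mul_le_mul_left A hn, Nat.zero_le (D * A * n ^ 2),
      Nat.zero_le (D * n ^ 2), Nat.zero_le (D * A), Nat.zero_le (A * n ^ 2)]
  · refine (hM.accepts_iff (init_machine _ _ _ _ _) (hsearch w) (hhalt w) ?_ fun hw => ?_).symm
    · rintro c (⟨-, hc⟩ | ⟨hc, -⟩) hacc
      · exact hc
      · cases hc.symm.trans hacc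
    · refine ⟨_, le_rfl, (hsearch w).imp fun c hc => ⟨hhalt w c hc, ?_⟩⟩
      exact hc.elim And.left fun h => absurd hw h.2

theorem not_composite_le_refl_mem_nTime (hf : ∀ a, IsFGEssentialIso (f a)) :
    {w | ¬ composite f w ≤ PEquiv.refl Word} ∈ NTime (fun n => n) := by
  obtain ⟨K, B, hT⟩ := exists_isTableFamily hf
  have hstrategy (w : List Γ) : IsStrategy (Γ := Γ) (fun _ => Set.univ) (dom (composite f w))
      {u | NoProperPrefix (dom (composite f w)) u} :=
    ⟨fun _ _ _ => Set.univ_nonempty, fun _ hu hD b _ => hu.concat hD b⟩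
  have hpass (w : List Γ) : Within (Step f (fun _ => Set.univ) false)
      (fun c : Conf Γ B => c.state = .fixed ∨
        (c.state = .moved ∧ ¬ composite f w ≤ PEquiv.refl Word))
      ((2 * B + 2 * K + 4) * w.length + 4) (start w []) := by
    refine (within_pass hT (hstrategy w) subset_rfl (noProperPrefix_nil _)).imp ?_
    rintro c ⟨u, hu, -, ⟨-, rfl⟩ | ⟨hmoved, hc⟩⟩
    · exact .inl rfl
    · exact .inr ⟨hc, fun h => hmoved ((hT.composite_iso w).le_refl_iff.1 h u hu)⟩
  have hM := realizes_step f Set.univ false {(.moved : State Γ B)}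
  have hhalt (w : List Γ) (c : Conf Γ B) (hc : c.state = .fixed ∨
        (c.state = .moved ∧ ¬ composite f w ≤ PEquiv.refl Word)) :=
    not_step (f := f) (choice := fun _ => Set.univ) (search := false) (hc.imp_right And.left)
  refine ⟨machine f B Set.univ false {.moved}, 2 * B + 2 * K + 4, fun w t c hc => ?_,
    fun w => ?_⟩
  · rw [init_machine] at hc
    exact (hM.of_computes (hpass w) (hhalt w) hc).1.trans (by simp)
  · refine (hM.accepts_iff (init_machine _ _ _ _ _) (hpass w) (hhalt w) ?_ fun hw => ?_).symm
    · rintro c (hc | ⟨-, hc⟩) hacc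
      · cases hc.symm.trans hacc
      · exact hc
    · rw [Set.mem_ofPred_eq, (hT.composite_iso w).le_refl_iff] at hw
      push Not at hw
      obtain ⟨u, hu, hmoved⟩ := hw
      exact ⟨_, step_mono fun _ => Set.subset_univ _,
        (within_moved hT hu hmoved).imp fun c hc => ⟨not_step (.inr hc), hc⟩⟩

end Complexity

end Thompson

theorem mainTheorem6_general {Γ : Type} [Finite Γ] (x : Γ → Thompson.V) :
    {w : List Γ | (w.map x).prod = 1} ∈ TimeComplexity.coNTime (fun n => n) ∧
    {w : List Γ | (w.map x).prod = 1} ∈ TimeComplexity.DTime (fun n => n ^ 2) := by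
  simp only [Thompson.prod_eq_one_iff]
  have hx (a : Γ) := (x a)⁻¹.isFGEssentialIso
  exact ⟨Thompson.not_composite_le_refl_mem_nTime hx,
    Thompson.composite_le_refl_mem_dTime hx⟩

theorem mainTheorem6 (Δ : Finset Thompson.V) :
    wordProblem Δ ∈ TimeComplexity.coNTime (fun n => n) ∧
    wordProblem Δ ∈ TimeComplexity.NTime (fun n => n ^ 2) ∧
    wordProblem Δ ∈ TimeComplexity.DTime (fun n => n ^ 3) := by
  obtain ⟨hcoN, hD⟩ := mainTheorem6_general (letterValue (Δ := Δ))
  exact ⟨hcoN, TimeComplexity.dTime_subset_nTime hD, TimeComplexity.dTime_mono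
    (fun n => n.eq_zero_or_pos.elim (by simp +contextual) (Nat.pow_le_pow_right · (by simp))) hD⟩
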